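/- Let $d\in\{1,2,\dots\}\cup\{\infty\}$, and let $\mathbb{F}^d$ be the free monoid of words in $d$ letters. The NC Hardy space $H^2$ is the Hilbert space of free power series $f=\sum_{\alpha\in\mathbb{F}^d}\hat f_\alpha\mathfrak{z}^\alpha$ with $\sum_\alpha|\hat f_\alpha|^2<\infty$, and $H^\infty\subseteq H^2$ is the algebra of its left multipliers: those $F$ for which $F(L)\colon g\mapsto F\cdot g$ maps $H^2$ into itself. For $n\in\{1,2,\dots\}\cup\{\infty\}$ (with $\mathbb{C}^\infty:=\ell^2(\mathbb{N})$) let $\mathbb{B}^d_n$ be the set of $d$-tuples $Z=(Z_1,Z_2,\dots)$ of bounded operators on $\mathbb{C}^n$ whose row operator $(x_i)_i\mapsto\sum_i Z_ix_i$, from the Hilbert space direct sum of $d$ copies of $\mathbb{C}^n$ to $\mathbb{C}^n$, has norm $<1$; any $f\in H^2$ has the norm-convergent value $f(Z)=\sum_\alpha\hat f_\alpha Z^\alpha$. For $H\in H^2$ define the left NC variety $\mathrm{Sing}(H)=\bigsqcup_{n}\{(Z,y)\in\mathbb{B}^d_n\times\mathbb{C}^n : y^*H(Z)=0\}$ and the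 singularity space $\mathscr{S}(H)=\{h\in H^2 : y^*h(Z)=0\ \text{for all}\ (Z,y)\in\mathrm{Sing}(H)\}$. An element $\Theta\in H^\infty$ is NC inner if $\Theta(L)$ is an isometry; an NC inner $\Theta$ is Blaschke if $\mathrm{Ran}\,\Theta(L)=\mathscr{S}(\Theta)$ and singular if $\mathscr{S}(\Theta)=H^2$. An element $F\in H^\infty$ is NC outer if $F(L)$ has dense range, and $F\in H^2$ is NC outer if it is cyclic for the right shifts $R_k\colon f\mapsto f\cdot\mathfrak{z}_k$. Theorem (NC Blaschke-Singular-Outer factorization). Let $p\in\{2,\infty\}$. Every non-zero $H\in H^p$ factors as $H=B\cdot S\cdot F$, where $B,S\in H^\infty$, $F\in H^p$, $B$ is an NC Blaschke inner with $\mathrm{Sing}(B)=\mathrm{Sing}(H)$, $S$ is an NC singular inner such that $S(Z)$ is invertible for all $Z\in\mathbb{B}^d_n$ and all $n\in\{1,2,\dots\}\cup\{\infty\}$, and $F$ is NC outer. The factors are unique up to constants of unit modulus: if $H=BSF=B'S'F'$ with $B,B'\in H^\infty$ Blaschke, $S,S'\in H^\infty$ singular and $F,F'\in H^p$ NC outer,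 then $B'=bB$, $S'=sS$, $F'=fF$ for some $b,s,f\in\mathbb{C}$ of modulus $1$. -/

import Mathlib

open scoped ENNReal

noncomputable section

namespace NCHardy

/-- Words in the letters `ι`, i.e. elements of the free monoid on `ι`; the product of words is
concatenation of lists. -/
abbrev Word (ι : Type*) := List ι

/-- The NC Hardy space `H²`: free power series `f = ∑ f_α 𝔷^α` with square-summable coefficients,
identified with the coefficient sequence in `ℓ²` of the free monoid (the full Fock space). -/
abbrev H2 (ι : Type*) := lp (fun _ : Word ι => ℂ) 2

/-- The product of two free formal power series (given by their coefficients):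
`(f g)_γ = ∑_{α β = γ} f_α g_β`. -/
def seriesMul {ι : Type*} (f g : Word ι → ℂ) : Word ι → ℂ := fun w =>
  ∑ i ∈ Finset.range (w.length + 1), f (w.take i) * g (w.drop i)

/-- The NC Hardy algebra `H^∞`, as the algebra of left multipliers of `H²`:
those `F` with `F · g ∈ H²` for all `g ∈ H²` (by the constant series `1 ∈ H²`, `F ∈ H²`). -/
def Hinf (ι : Type*) : Set (H2 ι) :=
  {F | ∀ g : H2 ι, Memℓp (seriesMul (F : Word ι → ℂ) (g : Word ι → ℂ)) 2}

/-- The left multiplication operator `F(L) = M^L_F : H² → H²`, `g ↦ F · g`, for `F ∈ H^∞`. -/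
def leftMul {ι : Type*} (F : Hinf ι) (g : H2 ι) : H2 ι :=
  ⟨seriesMul ((F : H2 ι) : Word ι → ℂ) (g : Word ι → ℂ), F.2 g⟩

theorem memlp_rightShift {ι : Type*} (k : ι) (f : H2 ι) :
    Memℓp (Function.extend (fun w : Word ι => w ++ [k]) (f : Word ι → ℂ) 0) 2 := by
  have hinj : Function.Injective (fun w : Word ι => w ++ [k]) := fun a b h =>
    List.append_cancel_right h
  have h2 : (0 : ℝ) < (2 : ℝ≥0∞).toReal := by norm_num
  refine memℓp_gen ?_
  have hf := (lp.memℓp f).summable h2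
  refine (hinj.summable_iff ?_).1 ?_
  · intro w hw
    rw [Function.extend_apply' _ _ _ (by simpa using hw)]
    simp
  · refine hf.congr fun w => ?_
    simp only [Function.comp_apply]
    rw [hinj.extend_apply]

/-- The right free shift `R_k f = f · 𝔷_k`: the coefficient of `R_k f` at the word `α k` is `f_α`,
and it is `0` at words which do not end in `k`. -/
def rightShift {ι : Type*} (k : ι) (f : H2 ι) : H2 ι :=
  ⟨Function.extend (fun w : Word ι => w ++ [k]) (f : Word ι → ℂ) 0, memlp_rightShift k f⟩

/-- The Hilbert space `ℂⁿ` of level `n ∈ ℕ ∪ {∞}`, with `ℂ^∞ = ℓ²(ℕ)`. -/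
abbrev Level (n : ℕ∞) := lp (fun _ : {k : ℕ // (k : ℕ∞) < n} => ℂ) 2

/-- `Z = (Z_i)` is a strict row contraction: as an operator from the Hilbert space direct sum of
copies of `E` (indexed by `ι`) to `E`, `(x_i) ↦ ∑ Z_i x_i`, it has norm `< 1`. For infinite `ι`
this is tested on the dense subspace of finitely supported columns. -/
def IsStrictRowContraction {ι E : Type*} [NormedAddCommGroup E] [NormedSpace ℂ E]
    (Z : ι → E →L[ℂ] E) : Prop :=
  ∃ r : ℝ, 0 ≤ r ∧ r < 1 ∧ ∀ (s : Finset ι) (x : ι → E),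
    ‖∑ i ∈ s, Z i (x i)‖ ^ 2 ≤ r ^ 2 * ∑ i ∈ s, ‖x i‖ ^ 2

/-- The value `f(Z) = ∑_α f_α Z^α` (operator norm convergent for `f ∈ H²` and strict row
contractions `Z`), where `Z^α = Z_{i₁} ⋯ Z_{iₘ}` for `α = i₁ ⋯ iₘ`. -/
def eval {ι E : Type*} [NormedAddCommGroup E] [NormedSpace ℂ E]
    (f : H2 ι) (Z : ι → E →L[ℂ] E) : E →L[ℂ] E :=
  ∑' w : Word ι, f w • (w.map Z).prod

/-- The left singularity locus (left NC variety) of `H`: all `(Z, y)` at all levels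
`n ∈ {1, 2, …} ∪ {∞}`, with `Z` a strict row contraction on `ℂⁿ`, `y ∈ ℂⁿ` and `y^* H(Z) ≡ 0`. -/
def Sing {ι : Type*} (H : H2 ι) :
    Set (Σ n : ℕ∞, (ι → Level n →L[ℂ] Level n) × Level n) :=
  {p | p.1 ≠ 0 ∧ IsStrictRowContraction p.2.1 ∧
    ∀ x : Level p.1, inner ℂ p.2.2 (eval H p.2.1 x) = 0}

/-- The singularity space of `H`: all `h ∈ H²` with `y^* h(Z) ≡ 0` for all
`(Z, y)` in the left NC variety of `H`. -/
def singSpace {ι : Type*} (H : H2 ι) : Set (H2 ι) :=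
  {h | ∀ p ∈ Sing H, ∀ x : Level p.1, inner ℂ p.2.2 (eval h p.2.1 x) = 0}

/-- `Θ ∈ H^∞` is NC inner: `Θ(L)` is an isometry. -/
def IsInner {ι : Type*} (Θ : Hinf ι) : Prop := Isometry (leftMul Θ)

/-- An NC inner `Θ` is Blaschke if the range of `Θ(L)` is the singularity space of `Θ`. -/
def IsBlaschke {ι : Type*} (Θ : Hinf ι) : Prop :=
  IsInner Θ ∧ Set.range (leftMul Θ) = singSpace (Θ : H2 ι)

/-- An NC inner `Θ` is singular if its singularity space is all of `H²`. -/
def IsSingular {ι : Type*} (Θ : Hinf ι) : Prop :=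
  IsInner Θ ∧ singSpace (Θ : H2 ι) = Set.univ

/-- `F ∈ H^∞` is NC outer: `F(L)` has dense range. -/
def IsOuterInf {ι : Type*} (F : Hinf ι) : Prop := DenseRange (leftMul F)

/-- `h ∈ H²` is NC outer: it is cyclic for the right shifts, i.e. the vectors
`R_{i₁} ⋯ R_{iₘ} h` span a dense subspace of `H²`. -/
def IsOuter {ι : Type*} (h : H2 ι) : Prop :=
  Dense (Submodule.span ℂ (Set.range fun w : Word ι => w.foldr rightShift h) : Set (H2 ι))

end NCHardy

end

/-!
The factorization is governed by the closed right-invariant subspaces of `H²` generated by a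
single element `f`, here `cyclicSpace f`. The normalized projection of `f` onto the orthogonal
complement of its proper right shifts is a wandering vector `Θ`; it is inner, its range is
`cyclicSpace f`, and so `f = Θ g` with `g` outer (`exists_isInner_cyclicSpace_eq`,
`exists_inner_outer`).

Write `f_c = f(c 𝔷)` for the dilates of `f`. Evaluation at the scaled left shifts `c L` with `c <
1` is multiplication by `f_c`, and these tuples occur, up to unitary equivalence, at the level
`∞`. Hence `h` lies in the singularity space of `H` if and only if `h_c` lies in `cyclicSpace H_c`
for all `0 < c < 1` (`mem_singSpace_iff`). Let `Φ_c` be inner with range `cyclicSpace H_c`, and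
let `B` be a coefficientwise limit of the `Φ_c` along an ultrafilter as `c → 1`. Dividing `h_c` by
`Φ_c` and passing to the limit gives `h = B g` with `‖g‖ ≤ ‖h‖` for every `h` in the singularity
space. Also `B` itself lies in that space, since it is a limit of the `(Φ_c)_{d/c}`, which lie in
`cyclicSpace H_d`. As products of free series can be cancelled, `‖p‖ ≤ ‖B p‖ ≤ ‖p‖` follows for
all `p`: `B` is inner and its range is the singularity space (`exists_isInner_singSpace_eq`).

Write `H = B G` and `G = S F` with `S` inner and `F` outer. To see that the values of `S` are
invertible, let `H_c = Φ K` be an inner-outer factorization. Then `B_c = Φ A` for a multiplier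
`A`, so that `K = A G_c`. Values of the outer `K` have right inverses, because `K p ≈ 1` in `H²`
for some polynomial `p`; so those of `A` have right inverses as well. An element of `H²` whose
values all have right inverses has invertible values, since `Z` is joined to `0` by the path `t Z`
and right invertible operators on a connected path are all invertible if one of them is
(`isUnit_eval_of_right_inverse`). So `A` and `K`, hence `G`, hence `S` have invertible values. It
follows that `Sing B = Sing H`, that `B` is Blaschke and that `S` is singular.

Uniqueness holds since `Sing H = Sing B` determines the range of `B`, the cofactor `S F` of `B`
generates the range of `S`, and inner multipliers with equal ranges agree up to a unimodular
constant (`IsInner.eq_smul_of_cyclicSpace_eq`). For a multiplier `H`, the factor `F` is a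
multiplier because the left factors are isometric (`IsInner.mem_Hinf_of_mul`).
-/

noncomputable section

namespace NCHardy

open Filter Topology

variable {ι : Type*}

/-! ### The algebra of free power series -/

section Series

variable {f g h : Word ι → ℂ}

@[simp] lemma seriesMul_nil (f g : Word ι → ℂ) : seriesMul f g [] = f [] * g [] := by
  simp [seriesMul]

lemma seriesMul_cons (f g : Word ι → ℂ) (a : ι) (w : Word ι) :
    seriesMul f g (a :: w) = f [] * g (a :: w) + seriesMul (fun v => f (a :: v)) g w := by
  simp only [seriesMul, List.length_cons]
  rw [Finset.sum_range_succ']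
  simp [add_comm]

lemma seriesMul_add_left (f f' g : Word ι → ℂ) :
    seriesMul (f + f') g = seriesMul f g + seriesMul f' g := by
  funext w; simp [seriesMul, add_mul, Finset.sum_add_distrib]

lemma seriesMul_add_right (f g g' : Word ι → ℂ) :
    seriesMul f (g + g') = seriesMul f g + seriesMul f g' := by
  funext w; simp [seriesMul, mul_add, Finset.sum_add_distrib]

lemma seriesMul_smul_left (c : ℂ) (f g : Word ι → ℂ) :
    seriesMul (c • f) g = c • seriesMul f g := by
  funext w; simp [seriesMul, Finset.mul_sum, mul_assoc]

lemma seriesMul_smul_right (c : ℂ) (f g : Word ι → ℂ) :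
    seriesMul f (c • g) = c • seriesMul f g := by
  funext w; simp [seriesMul, Finset.mul_sum, mul_left_comm]

lemma seriesMul_assoc (f g h : Word ι → ℂ) :
    seriesMul (seriesMul f g) h = seriesMul f (seriesMul g h) := by
  funext w
  induction w generalizing f with
  | nil => simp [mul_assoc]
  | cons a w ih =>
    have key : (fun v => seriesMul f g (a :: v)) =
        f [] • (fun v => g (a :: v)) + seriesMul (fun v => f (a :: v)) g := by
      funext v; simp [seriesMul_cons]
    rw [seriesMul_cons, key, seriesMul_add_left, seriesMul_smul_left, seriesMul_cons f,
      seriesMul_cons g]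
    simp only [Pi.add_apply, ih, Pi.smul_apply, smul_eq_mul, seriesMul_nil]
    ring

lemma exists_minimal_length (hf : f ≠ 0) :
    ∃ u, f u ≠ 0 ∧ ∀ w : Word ι, w.length < u.length → f w = 0 := by
  obtain ⟨u, hu⟩ := Function.ne_iff.1 hf
  obtain ⟨u, hu, hmin⟩ :=
    exists_minimalFor_of_wellFoundedLT (fun w => f w ≠ 0) List.length ⟨u, hu⟩
  refine ⟨u, hu, fun w hw => ?_⟩
  by_contra h
  exact absurd (hmin h hw.le) (by simpa using hw)

/-- The ring of free power series has no zero divisors: the product of the coefficients at words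
of minimal length in the supports of `f` and `g` is a coefficient of `f g`. -/
lemma eq_zero_of_seriesMul_eq_zero (hf : f ≠ 0) (hfg : seriesMul f g = 0) : g = 0 := by
  classical
  by_contra hg
  obtain ⟨u, hu, humin⟩ := exists_minimal_length hf
  obtain ⟨v, hv, hvmin⟩ := exists_minimal_length hg
  have : seriesMul f g (u ++ v) = f u * g v := by
    unfold seriesMul
    rw [Finset.sum_eq_single u.length]
    · simp
    · intro i hi hne
      rcases lt_or_gt_of_ne hne with hlt | hgt
      · rw [humin _ (by simp; omega), zero_mul]
      · rw [hvmin _ (by simp at hi ⊢; omega), mul_zero]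
    · intro h; simp at h
  rw [hfg] at this
  simp_all

lemma seriesMul_left_cancel (hf : f ≠ 0) (H : seriesMul f g = seriesMul f h) : g = h := by
  rw [← sub_eq_zero]
  refine eq_zero_of_seriesMul_eq_zero hf ?_
  rw [sub_eq_add_neg, ← neg_one_smul ℂ h, seriesMul_add_right, seriesMul_smul_right, H]
  simp

lemma tendsto_seriesMul {κ : Type*} {l : Filter κ} {F G : κ → Word ι → ℂ}
    (hF : ∀ w, Tendsto (fun k => F k w) l (𝓝 (f w)))
    (hG : ∀ w, Tendsto (fun k => G k w) l (𝓝 (g w))) (w : Word ι) :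
    Tendsto (fun k => seriesMul (F k) (G k) w) l (𝓝 (seriesMul f g w)) :=
  tendsto_finsetSum _ fun _ _ => (hF _).mul (hG _)

end Series

/-! ### Monomials and word shifts on `H²` -/

lemma norm_sq_eq_tsum {α : Type*} (f : lp (fun _ : α => ℂ) 2) : ‖f‖ ^ 2 = ∑' a, ‖f a‖ ^ 2 := by
  have := lp.norm_rpow_eq_tsum (p := 2) (by norm_num) f
  simpa using this

lemma summable_norm_sq {α : Type*} (f : lp (fun _ : α => ℂ) 2) : Summable fun a => ‖f a‖ ^ 2 := by
  have := (lp.memℓp f).summable (by norm_num)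
  simpa using this

lemma memlp_extend {α β : Type*} {e : α → β} (he : Function.Injective e)
    (f : lp (fun _ : α => ℂ) 2) : Memℓp (Function.extend e (f : α → ℂ) 0) 2 := by
  refine memℓp_gen ((he.summable_iff ?_).1 ?_)
  · intro w hw
    rw [Function.extend_apply' _ _ _ (by simpa using hw)]
    simp
  · refine ((lp.memℓp f).summable (by norm_num)).congr fun w => ?_
    simp [he.extend_apply]

/-- Extension by zero along an injection of index sets, as an isometry of `ℓ²` spaces. -/
def pushforward {α β : Type*} (e : α → β) (he : Function.Injective e) :
    lp (fun _ : α => ℂ) 2 →ₗᵢ[ℂ] lp (fun _ : β => ℂ) 2 where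
  toFun f := ⟨Function.extend e (f : α → ℂ) 0, memlp_extend he f⟩
  map_add' f g := by
    ext b
    by_cases hb : ∃ a, e a = b
    · obtain ⟨a, rfl⟩ := hb
      change Function.extend e (f + g : α → ℂ) 0 (e a) =
        Function.extend e (f : α → ℂ) 0 (e a) + Function.extend e (g : α → ℂ) 0 (e a)
      simp only [he.extend_apply, Pi.add_apply]
    · change Function.extend e (f + g : α → ℂ) 0 b =
        Function.extend e (f : α → ℂ) 0 b + Function.extend e (g : α → ℂ) 0 b
      simp [Function.extend_apply' _ _ _ hb]
  map_smul' c f := by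
    ext b
    by_cases hb : ∃ a, e a = b
    · obtain ⟨a, rfl⟩ := hb
      simp [he.extend_apply]
    · simp [Function.extend_apply' _ _ _ hb]
  norm_map' f := by
    rw [← sq_eq_sq₀ (norm_nonneg _) (norm_nonneg _), norm_sq_eq_tsum, norm_sq_eq_tsum]
    rw [← he.tsum_eq]
    · refine tsum_congr fun a => ?_
      change ‖Function.extend e (f : α → ℂ) 0 (e a)‖ ^ 2 = _
      rw [he.extend_apply]
    · intro b hb
      by_contra h
      refine hb ?_
      change ‖Function.extend e (f : α → ℂ) 0 b‖ ^ 2 = _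
      rw [Function.extend_apply' _ _ _ (by simpa using h)]
      simp

@[simp] lemma pushforward_apply {α β : Type*} {e : α → β} (he : Function.Injective e)
    (f : lp (fun _ : α => ℂ) 2) (a : α) : pushforward e he f (e a) = f a :=
  he.extend_apply _ _ _

lemma pushforward_apply_of_notMem {α β : Type*} {e : α → β} (he : Function.Injective e)
    (f : lp (fun _ : α => ℂ) 2) {b : β} (hb : ¬ ∃ a, e a = b) : pushforward e he f b = 0 :=
  Function.extend_apply' _ _ _ hb

open Classical in
/-- The monomial `𝔷^w`, an element of the standard orthonormal basis of `H²`. -/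
def mono (w : Word ι) : H2 ι := lp.single 2 w 1

open Classical in
lemma mono_apply (w v : Word ι) : mono w v = if v = w then 1 else 0 := by
  simp [mono, lp.single_apply, Pi.single_apply]

@[simp] lemma mono_apply_self (w : Word ι) : mono w w = 1 := by simp [mono_apply]

lemma mono_apply_ne {w v : Word ι} (h : v ≠ w) : mono w v = 0 := by simp [mono_apply, h]

@[simp] lemma norm_mono (w : Word ι) : ‖mono w‖ = 1 := by
  simp [mono, lp.norm_single (p := 2) (by norm_num)]

lemma inner_mono_left (w : Word ι) (f : H2 ι) : inner ℂ (mono w) f = f w := by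
  classical
  simp [mono, lp.inner_single_left]

lemma hasSum_mono (f : H2 ι) : HasSum (fun w => f w • mono w) f := by
  classical
  convert lp.hasSum_single (p := 2) (by norm_num) f using 2 with w
  simp [mono, ← lp.single_smul]

@[simp] lemma pushforward_mono {κ : Type*} {e : Word ι → Word κ} (he : Function.Injective e)
    (w : Word ι) : pushforward e he (mono w) = mono (e w) := by
  ext v
  by_cases hv : ∃ u, e u = v
  · obtain ⟨u, rfl⟩ := hv
    rw [pushforward_apply, mono_apply, mono_apply]
    by_cases h : u = w
    · simp [h]
    · simp [h, he.ne h]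
  · rw [pushforward_apply_of_notMem he _ hv, mono_apply_ne]
    rintro rfl
    exact hv ⟨_, rfl⟩

/-- Continuous linear maps on `H²` are determined by their values on monomials. -/
lemma clm_ext {E : Type*} [NormedAddCommGroup E] [NormedSpace ℂ E] {S T : H2 ι →L[ℂ] E}
    (h : ∀ w, S (mono w) = T (mono w)) : S = T := by
  ext f
  have hS := (hasSum_mono f).mapL S
  have hT := (hasSum_mono f).mapL T
  simp only [map_smul, h] at hS hT
  exact hS.unique hT

lemma map_mem_of_mono {E : Type*} [NormedAddCommGroup E] [NormedSpace ℂ E] {T : H2 ι →L[ℂ] E}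
    {M : Submodule ℂ E} (hM : IsClosed (M : Set E)) (h : ∀ w, T (mono w) ∈ M) (f : H2 ι) :
    T f ∈ M := by
  have hT := (hasSum_mono f).mapL T
  simp only [map_smul] at hT
  exact hM.mem_of_tendsto hT (Eventually.of_forall fun s => M.sum_mem fun w _ => M.smul_mem _ (h w))

/-- Right multiplication by the monomial `𝔷^w`. -/
def rightMono (w : Word ι) : H2 ι →ₗᵢ[ℂ] H2 ι :=
  pushforward (fun v => v ++ w) fun _ _ h => List.append_cancel_right h

/-- Left multiplication by the monomial `𝔷^w`. -/
def leftMono (w : Word ι) : H2 ι →ₗᵢ[ℂ] H2 ι :=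
  pushforward (fun v => w ++ v) fun _ _ h => List.append_cancel_left h

@[simp] lemma rightMono_apply_append (w v : Word ι) (f : H2 ι) : rightMono w f (v ++ w) = f v :=
  pushforward_apply (e := fun v => v ++ w) _ f v

lemma rightMono_apply_of_not_suffix {w v : Word ι} (h : ¬ w <:+ v) (f : H2 ι) :
    rightMono w f v = 0 :=
  pushforward_apply_of_notMem _ _ fun ⟨u, hu⟩ => h ⟨u, hu⟩

@[simp] lemma rightMono_mono (w v : Word ι) : rightMono w (mono v) = mono (v ++ w) :=
  pushforward_mono _ _

@[simp] lemma leftMono_mono (w v : Word ι) : leftMono w (mono v) = mono (w ++ v) :=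
  pushforward_mono _ _

@[simp] lemma rightMono_nil (f : H2 ι) : rightMono [] f = f := by
  ext v
  have := rightMono_apply_append [] v f
  rwa [List.append_nil] at this

lemma rightMono_append (u v : Word ι) (f : H2 ι) :
    rightMono (u ++ v) f = rightMono v (rightMono u f) := by
  have : (rightMono (u ++ v)).toContinuousLinearMap =
      (rightMono v).toContinuousLinearMap ∘L (rightMono u).toContinuousLinearMap :=
    clm_ext fun w => by simp
  exact DFunLike.congr_fun this f

lemma leftMono_append (u v : Word ι) (f : H2 ι) :
    leftMono (u ++ v) f = leftMono u (leftMono v f) := by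
  have : (leftMono (u ++ v)).toContinuousLinearMap =
      (leftMono u).toContinuousLinearMap ∘L (leftMono v).toContinuousLinearMap :=
    clm_ext fun w => by simp
  exact DFunLike.congr_fun this f

lemma rightMono_singleton (k : ι) (f : H2 ι) : rightMono [k] f = rightShift k f := rfl

lemma foldr_rightShift (w : Word ι) (f : H2 ι) :
    w.foldr rightShift f = rightMono w.reverse f := by
  induction w with
  | nil => simp
  | cons a w ih => rw [List.foldr_cons, ih, List.reverse_cons, rightMono_append,
      rightMono_singleton]

lemma seriesMul_mono (f : H2 ι) (w : Word ι) : seriesMul f (mono w) = rightMono w f := by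
  funext v
  unfold seriesMul
  by_cases h : w <:+ v
  · obtain ⟨u, rfl⟩ := h
    rw [rightMono_apply_append, Finset.sum_eq_single u.length]
    · simp
    · intro i hi hne
      rw [mono_apply_ne, mul_zero]
      intro h
      have := congr_arg List.length h
      simp at this hi
      omega
    · intro h; simp at h
  · rw [rightMono_apply_of_not_suffix h]
    refine Finset.sum_eq_zero fun i _ => ?_
    rw [mono_apply_ne, mul_zero]
    rintro rfl
    exact h (List.drop_suffix _ _)

lemma seriesMul_rightMono (f g : H2 ι) (w : Word ι) :
    seriesMul f (rightMono w g) = seriesMul (seriesMul f g) (mono w) := by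
  rw [← seriesMul_mono, seriesMul_assoc]

/-- The partial sums `∑_{w ∈ s} g_w 𝔷^w` of `g` satisfy `F · (∑_{w ∈ s} g_w 𝔷^w) → F · g`
coefficientwise. -/
lemma tendsto_sum_rightMono (F g : H2 ι) (v : Word ι) :
    Tendsto (fun s : Finset (Word ι) => (∑ w ∈ s, g w • rightMono w F) v) atTop
      (𝓝 (seriesMul F g v)) := by
  classical
  refine (tendsto_congr fun s => ?_).1 (tendsto_seriesMul (F := fun _ => F)
    (G := fun s => (∑ w ∈ s, g w • mono w : H2 ι)) (fun w => tendsto_const_nhds) (fun w => ?_) v)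
  · induction s using Finset.induction_on with
    | empty => simp [seriesMul]
    | insert a s ha ih =>
      rw [Finset.sum_insert ha, Finset.sum_insert ha, lp.coeFn_add, lp.coeFn_add,
        seriesMul_add_right, Pi.add_apply, Pi.add_apply, ih, lp.coeFn_smul, lp.coeFn_smul,
        seriesMul_smul_right, seriesMul_mono]
  · exact ((lp.evalCLM ℂ (fun _ : Word ι => ℂ) 2 w).continuous.tendsto g).comp (hasSum_mono g)

/-! ### Left multipliers -/

lemma coe_leftMul (F : Hinf ι) (g : H2 ι) :
    (leftMul F g : Word ι → ℂ) = seriesMul (F : H2 ι) g := rfl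

lemma tendsto_coeff {κ : Type*} {l : Filter κ} {u : κ → H2 ι} {x : H2 ι} (h : Tendsto u l (𝓝 x))
    (w : Word ι) : Tendsto (fun k => u k w) l (𝓝 (x w)) :=
  ((lp.evalCLM ℂ (fun _ : Word ι => ℂ) 2 w).continuous.tendsto x).comp h

/-- Left multiplication by `F ∈ H^∞` as a linear map. -/
def leftMulLinear (F : Hinf ι) : H2 ι →ₗ[ℂ] H2 ι where
  toFun := leftMul F
  map_add' g h := lp.ext (by simp only [coe_leftMul, lp.coeFn_add, seriesMul_add_right])
  map_smul' c g := lp.ext (by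
    simp only [coe_leftMul, lp.coeFn_smul, seriesMul_smul_right, RingHom.id_apply])

lemma continuous_leftMulLinear (F : Hinf ι) : Continuous (leftMulLinear F) := by
  refine LinearMap.continuous_of_seq_closed_graph _ fun u x y hu hy => lp.ext (funext fun w => ?_)
  have h1 : Tendsto (fun n => leftMulLinear F (u n) w) atTop (𝓝 (y w)) := tendsto_coeff hy w
  exact tendsto_nhds_unique h1 (tendsto_seriesMul (f := (F : H2 ι)) (F := fun _ => (F : H2 ι))
    (G := fun n => u n) (fun _ => tendsto_const_nhds) (tendsto_coeff hu) w)

/-- Left multiplication by `F ∈ H^∞` as a bounded operator; boundedness is the closed graph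
theorem. -/
def mulL (F : Hinf ι) : H2 ι →L[ℂ] H2 ι := ⟨leftMulLinear F, continuous_leftMulLinear F⟩

@[simp] lemma mulL_apply (F : Hinf ι) (g : H2 ι) : mulL F g = leftMul F g := rfl

lemma coe_mulL (F : Hinf ι) (g : H2 ι) : (mulL F g : Word ι → ℂ) = seriesMul (F : H2 ι) g := rfl

lemma mulL_mono (F : Hinf ι) (w : Word ι) : mulL F (mono w) = rightMono w (F : H2 ι) :=
  lp.ext (seriesMul_mono _ _)

lemma mulL_one (F : Hinf ι) : mulL F (mono []) = F := by rw [mulL_mono, rightMono_nil]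

lemma mulL_rightMono (F : Hinf ι) (w : Word ι) (g : H2 ι) :
    mulL F (rightMono w g) = rightMono w (mulL F g) := by
  refine lp.ext ?_
  rw [coe_mulL, seriesMul_rightMono, ← coe_mulL, seriesMul_mono]

lemma mulL_injective {F : Hinf ι} (hF : (F : H2 ι) ≠ 0) : Function.Injective (mulL F) := by
  intro g h hgh
  refine lp.ext (seriesMul_left_cancel (f := (F : H2 ι)) ?_ ?_)
  · rwa [ne_eq, ← lp.eq_zero_iff_coeFn_eq_zero]
  · rw [← coe_mulL, ← coe_mulL, hgh]

/-- A bounded operator which agrees on monomials with multiplication by `F ∈ H²` is the left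
multiplication by `F`; in particular `F` is a multiplier. -/
lemma exists_mulL_eq (T : H2 ι →L[ℂ] H2 ι) (F : H2 ι) (h : ∀ w, T (mono w) = rightMono w F) :
    ∃ hF : F ∈ Hinf ι, mulL ⟨F, hF⟩ = T := by
  have key (g : H2 ι) : (T g : Word ι → ℂ) = seriesMul F g := by
    funext v
    have hT := (hasSum_mono g).mapL T
    simp only [map_smul, h] at hT
    exact tendsto_nhds_unique (tendsto_coeff hT v) (tendsto_sum_rightMono F g v)
  exact ⟨fun g => key g ▸ lp.memℓp (T g), ContinuousLinearMap.ext fun g => lp.ext (key g).symm⟩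

/-! ### Inner multipliers -/

lemma isInner_iff {Θ : Hinf ι} : IsInner Θ ↔ ∀ g, ‖mulL Θ g‖ = ‖g‖ :=
  AddMonoidHomClass.isometry_iff_norm (mulL Θ)

lemma IsInner.norm_mulL {Θ : Hinf ι} (hΘ : IsInner Θ) (g : H2 ι) : ‖mulL Θ g‖ = ‖g‖ :=
  isInner_iff.1 hΘ g

lemma IsInner.norm_eq_one {Θ : Hinf ι} (hΘ : IsInner Θ) : ‖(Θ : H2 ι)‖ = 1 := by
  rw [← mulL_one, hΘ.norm_mulL, norm_mono]

lemma IsInner.ne_zero {Θ : Hinf ι} (hΘ : IsInner Θ) : (Θ : H2 ι) ≠ 0 := by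
  intro h
  simpa [h] using hΘ.norm_eq_one

lemma IsInner.isClosed_map {Θ : Hinf ι} (hΘ : IsInner Θ) {M : Submodule ℂ (H2 ι)}
    (hM : IsClosed (M : Set (H2 ι))) :
    IsClosed ((M.map (mulL Θ : H2 ι →ₗ[ℂ] H2 ι) : Submodule ℂ (H2 ι)) : Set (H2 ι)) :=
  (Isometry.isClosedEmbedding hΘ).isClosedMap _ hM

lemma IsInner.isClosed_range {Θ : Hinf ι} (hΘ : IsInner Θ) :
    IsClosed ((LinearMap.range (mulL Θ : H2 ι →ₗ[ℂ] H2 ι)) : Set (H2 ι)) :=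
  (Isometry.isClosedEmbedding hΘ).isClosed_range

/-- If `B G = H` with `B` inner and `H` a multiplier, then `G` is a multiplier, and multiplication
by `G` has the norms of multiplication by `H`. -/
lemma IsInner.mem_Hinf_of_mul {B H : Hinf ι} (hB : IsInner B) {G : H2 ι}
    (h : mulL B G = H) : ∃ hG : G ∈ Hinf ι, ∀ g, mulL B (mulL ⟨G, hG⟩ g) = mulL H g := by
  have hrange (g : H2 ι) : mulL H g ∈ LinearMap.range (mulL B : H2 ι →ₗ[ℂ] H2 ι) :=
    map_mem_of_mono hB.isClosed_range (fun w => ⟨rightMono w G, by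
      simp only [ContinuousLinearMap.coe_coe]
      rw [mulL_rightMono, h, mulL_mono]⟩) g
  have hB0 : (B : H2 ι) ≠ 0 := hB.ne_zero
  rw [ne_eq, lp.eq_zero_iff_coeFn_eq_zero] at hB0
  have key (g : H2 ι) : ∃ k : H2 ι, seriesMul G g = k := by
    obtain ⟨k, hk⟩ := hrange g
    refine ⟨k, seriesMul_left_cancel hB0 ?_⟩
    rw [← seriesMul_assoc, ← coe_mulL, h, ← coe_mulL, ← coe_mulL, ← hk]
    rfl
  refine ⟨fun g => ?_, fun g => lp.ext ?_⟩
  · obtain ⟨k, hk⟩ := key g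
    exact hk ▸ lp.memℓp k
  · rw [coe_mulL, coe_mulL, ← seriesMul_assoc, ← coe_mulL, h, coe_mulL]

/-! ### Cyclic right-invariant subspaces -/

/-- The closed subspace of `H²` generated by the right shifts of `f`. -/
def cyclicSpace (f : H2 ι) : Submodule ℂ (H2 ι) :=
  (Submodule.span ℂ (Set.range fun w => rightMono w f)).topologicalClosure

lemma isClosed_cyclicSpace (f : H2 ι) : IsClosed (cyclicSpace f : Set (H2 ι)) :=
  Submodule.isClosed_topologicalClosure _

lemma rightMono_mem_cyclicSpace (w : Word ι) (f : H2 ι) : rightMono w f ∈ cyclicSpace f :=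
  Submodule.le_topologicalClosure _ (Submodule.subset_span ⟨w, rfl⟩)

lemma self_mem_cyclicSpace (f : H2 ι) : f ∈ cyclicSpace f := by
  simpa using rightMono_mem_cyclicSpace [] f

lemma cyclicSpace_le {f : H2 ι} {M : Submodule ℂ (H2 ι)} (hM : IsClosed (M : Set (H2 ι)))
    (h : ∀ w, rightMono w f ∈ M) : cyclicSpace f ≤ M :=
  Submodule.topologicalClosure_minimal _ (Submodule.span_le.2 <| by rintro _ ⟨w, rfl⟩; exact h w) hM

/-- A bounded operator which sends the right shifts of `f` into a closed subspace `M` maps the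
cyclic subspace of `f` into `M`. -/
lemma map_mem_of_mem_cyclicSpace {E : Type*} [NormedAddCommGroup E] [NormedSpace ℂ E] {f : H2 ι}
    (T : H2 ι →L[ℂ] E) {M : Submodule ℂ E} (hM : IsClosed (M : Set E))
    (h : ∀ w, T (rightMono w f) ∈ M) {x : H2 ι} (hx : x ∈ cyclicSpace f) : T x ∈ M :=
  cyclicSpace_le (M := M.comap (T : H2 ι →ₗ[ℂ] E)) (hM.preimage T.continuous) h hx

lemma rightMono_mem_of_mem_cyclicSpace {f x : H2 ι} (hx : x ∈ cyclicSpace f) (w : Word ι) :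
    rightMono w x ∈ cyclicSpace f :=
  map_mem_of_mem_cyclicSpace (rightMono w).toContinuousLinearMap (isClosed_cyclicSpace f)
    (fun v => by
      rw [LinearIsometry.coe_toContinuousLinearMap, ← rightMono_append]
      exact rightMono_mem_cyclicSpace _ _) hx

lemma cyclicSpace_mono {f g : H2 ι} (h : g ∈ cyclicSpace f) : cyclicSpace g ≤ cyclicSpace f :=
  cyclicSpace_le (isClosed_cyclicSpace f) (rightMono_mem_of_mem_cyclicSpace h)

lemma mulL_mem_cyclicSpace (F : Hinf ι) (g : H2 ι) : mulL F g ∈ cyclicSpace (F : H2 ι) :=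
  map_mem_of_mono (isClosed_cyclicSpace _)
    (fun w => by rw [mulL_mono]; exact rightMono_mem_cyclicSpace _ _) g

lemma isOuter_iff {f : H2 ι} : IsOuter f ↔ cyclicSpace f = ⊤ := by
  have : (Set.range fun w : Word ι => w.foldr rightShift f) =
      Set.range fun w => rightMono w f := by
    simp only [foldr_rightShift]
    exact List.reverse_surjective.range_comp (fun w => rightMono w f)
  rw [IsOuter, this, cyclicSpace, Submodule.dense_iff_topologicalClosure_eq_top]

/-- For multipliers, density of the range and cyclicity are equivalent, as polynomials are dense
in `H²`. -/
lemma isOuterInf_iff {F : Hinf ι} : IsOuterInf F ↔ IsOuter (F : H2 ι) := by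
  rw [isOuter_iff]
  constructor
  · intro h
    rw [eq_top_iff]
    intro x _
    refine (isClosed_cyclicSpace (F : H2 ι)).closure_subset_iff.2 ?_ (h x)
    rintro _ ⟨g, rfl⟩
    exact mulL_mem_cyclicSpace F g
  · intro h x
    have hx : x ∈ cyclicSpace (F : H2 ι) := h ▸ Submodule.mem_top
    refine cyclicSpace_le (M := (LinearMap.range (mulL F : H2 ι →ₗ[ℂ] H2 ι)).topologicalClosure)
      (Submodule.isClosed_topologicalClosure _)
      (fun w => Submodule.le_topologicalClosure _ ⟨mono w, mulL_mono F w⟩) hx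

lemma IsInner.range_eq_cyclicSpace {Θ : Hinf ι} (hΘ : IsInner Θ) :
    LinearMap.range (mulL Θ : H2 ι →ₗ[ℂ] H2 ι) = cyclicSpace (Θ : H2 ι) := by
  refine le_antisymm ?_ (cyclicSpace_le hΘ.isClosed_range fun w => ⟨mono w, mulL_mono Θ w⟩)
  rintro _ ⟨g, rfl⟩
  exact mulL_mem_cyclicSpace Θ g

lemma IsInner.mem_cyclicSpace {Θ : Hinf ι} (hΘ : IsInner Θ) {x : H2 ι} :
    x ∈ cyclicSpace (Θ : H2 ι) ↔ ∃ g, mulL Θ g = x := by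
  rw [← hΘ.range_eq_cyclicSpace]; rfl

lemma IsInner.isOuter_iff_cyclicSpace_mulL {Θ : Hinf ι} (hΘ : IsInner Θ) {g : H2 ι} :
    IsOuter g ↔ cyclicSpace (mulL Θ g) = cyclicSpace (Θ : H2 ι) := by
  have hmap : cyclicSpace (mulL Θ g) = (cyclicSpace g).map (mulL Θ : H2 ι →ₗ[ℂ] H2 ι) := by
    refine le_antisymm (cyclicSpace_le (hΘ.isClosed_map (isClosed_cyclicSpace g)) fun w =>
      ⟨rightMono w g, rightMono_mem_cyclicSpace w g, mulL_rightMono Θ w g⟩) ?_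
    rintro _ ⟨x, hx, rfl⟩
    exact map_mem_of_mem_cyclicSpace (mulL Θ) (isClosed_cyclicSpace _)
      (fun w => by rw [mulL_rightMono]; exact rightMono_mem_cyclicSpace _ _) hx
  rw [isOuter_iff, hmap, ← hΘ.range_eq_cyclicSpace, LinearMap.range_eq_map]
  constructor
  · intro h; rw [h]
  · intro h
    exact Submodule.map_injective_of_injective (mulL_injective hΘ.ne_zero) h

/-! ### Inner-outer factorization -/

lemma rightMono_singleton_inner {k l : ι} (x y : H2 ι) (h : k ≠ l) :
    inner ℂ (rightMono [k] x) (rightMono [l] y) = 0 := by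
  rw [lp.inner_eq_tsum]
  refine (tsum_congr fun w => ?_).trans tsum_zero
  by_cases hw : [k] <:+ w
  · rw [rightMono_apply_of_not_suffix (w := [l]), inner_zero_right]
    obtain ⟨u, rfl⟩ := hw
    rintro ⟨v, hv⟩
    exact h (by simpa using (List.append_inj_right' hv rfl).symm)
  · rw [rightMono_apply_of_not_suffix hw, inner_zero_left]

/-- A unit vector orthogonal to all its proper right shifts is inner. -/
lemma exists_isInner_of_wandering {θ : H2 ι} (h1 : ‖θ‖ = 1)
    (h : ∀ w ≠ [], inner ℂ θ (rightMono w θ) = 0) : ∃ Θ : Hinf ι, (Θ : H2 ι) = θ ∧ IsInner Θ := by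
  have horth (u v : Word ι) (huv : u ≠ v) : inner ℂ (rightMono u θ) (rightMono v θ) = 0 := by
    induction u using List.reverseRecOn generalizing v with
    | nil => simpa using h v huv.symm
    | append_singleton u k ih =>
      rcases List.eq_nil_or_concat' v with rfl | ⟨v, l, rfl⟩
      · rw [rightMono_nil, ← inner_conj_symm, h _ (by simp), map_zero]
      · rw [rightMono_append, rightMono_append]
        by_cases hkl : k = l
        · subst hkl
          rw [LinearIsometry.inner_map_map]
          exact ih v (by rintro rfl; exact huv rfl)
        · exact rightMono_singleton_inner _ _ hkl
  have hon : Orthonormal ℂ fun w => rightMono w θ := ⟨fun w => by simp [h1], fun u v => horth u v⟩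
  classical
  obtain ⟨hθ, hT⟩ := exists_mulL_eq hon.orthogonalFamily.linearIsometry.toContinuousLinearMap θ
    fun w => by simp [mono]
  refine ⟨⟨θ, hθ⟩, rfl, isInner_iff.2 fun g => ?_⟩
  rw [hT]
  exact LinearIsometry.norm_map _ _

open ContinuousLinearMap in
lemma adjoint_rightMono_apply (w v : Word ι) (x : H2 ι) :
    adjoint (rightMono w).toContinuousLinearMap x v = x (v ++ w) := by
  rw [← inner_mono_left, adjoint_inner_right]
  simp [inner_mono_left]

open ContinuousLinearMap in
/-- Every cyclic right-invariant subspace is the range of an inner multiplier `Θ`. The wandering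
vector `Θ` is the normalized component of `f` orthogonal to the span of the proper shifts of `f`. -/
theorem exists_isInner_cyclicSpace_eq {f : H2 ι} (hf : f ≠ 0) :
    ∃ Θ : Hinf ι, IsInner Θ ∧ cyclicSpace (Θ : H2 ι) = cyclicSpace f := by
  set N : Submodule ℂ (H2 ι) :=
    (Submodule.span ℂ ((fun w => rightMono w f) '' {w | w ≠ []})).topologicalClosure
  have hNc : IsClosed (N : Set (H2 ι)) := Submodule.isClosed_topologicalClosure _
  have hN_le {M : Submodule ℂ (H2 ι)} (hM : IsClosed (M : Set (H2 ι)))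
      (h : ∀ w ≠ [], rightMono w f ∈ M) : N ≤ M :=
    Submodule.topologicalClosure_minimal _
      (Submodule.span_le.2 <| by rintro _ ⟨w, hw, rfl⟩; exact h w hw) hM
  have hmemN (w : Word ι) (hw : w ≠ []) : rightMono w f ∈ N :=
    Submodule.le_topologicalClosure _ (Submodule.subset_span ⟨w, hw, rfl⟩)
  have hNM : N ≤ cyclicSpace f :=
    hN_le (isClosed_cyclicSpace f) fun w _ => rightMono_mem_cyclicSpace w f
  have hcoeff (u : Word ι) : IsClosed ((LinearMap.ker
      (lp.evalCLM ℂ (fun _ : Word ι => ℂ) 2 u : H2 ι →ₗ[ℂ] ℂ) : Submodule ℂ (H2 ι)) :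
        Set (H2 ι)) := (lp.evalCLM ℂ (fun _ : Word ι => ℂ) 2 u).isClosed_ker
  -- proper shifts of `f` vanish at a word of minimal length in the support of `f`
  have hfN : f ∉ N := by
    intro hmem
    obtain ⟨u, hu, hmin⟩ := exists_minimal_length
      (f := (f : Word ι → ℂ)) (by rwa [ne_eq, ← lp.eq_zero_iff_coeFn_eq_zero])
    refine hu (hN_le (hcoeff u) (fun w hw => ?_) hmem)
    change rightMono w f u = 0
    by_cases hwu : w <:+ u
    · obtain ⟨v, rfl⟩ := hwu
      rw [rightMono_apply_append]
      refine hmin v ?_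
      simpa using List.length_pos_iff.2 hw
    · exact rightMono_apply_of_not_suffix hwu f
  have : CompleteSpace N := hNc.completeSpace_coe
  set v : H2 ι := f - N.starProjection f with hv
  have hv0 : v ≠ 0 := by
    intro h
    rw [sub_eq_zero] at h
    exact hfN (h ▸ N.starProjection_apply_mem f)
  have hvN : v ∈ Nᗮ := N.sub_starProjection_mem_orthogonal f
  have hvM : v ∈ cyclicSpace f :=
    Submodule.sub_mem _ (self_mem_cyclicSpace f) (hNM (N.starProjection_apply_mem f))
  set θ : H2 ι := (‖v‖⁻¹ : ℂ) • v with hθ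
  have hvnorm : (‖v‖ : ℂ) ≠ 0 := by simpa using hv0
  have hvθ : v = (‖v‖ : ℂ) • θ := by rw [hθ, smul_smul, mul_inv_cancel₀ hvnorm, one_smul]
  have hθ1 : ‖θ‖ = 1 := by
    rw [hθ, norm_smul]; simp [hv0]
  have hθN : θ ∈ Nᗮ := Submodule.smul_mem _ _ hvN
  have hθM : θ ∈ cyclicSpace f := Submodule.smul_mem _ _ hvM
  have hshift (w : Word ι) (hw : w ≠ []) {x : H2 ι} (hx : x ∈ cyclicSpace f) :
      rightMono w x ∈ N :=
    map_mem_of_mem_cyclicSpace (rightMono w).toContinuousLinearMap hNc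
      (fun u => by
        rw [LinearIsometry.coe_toContinuousLinearMap, ← rightMono_append]
        exact hmemN _ (by simp [hw])) hx
  obtain ⟨Θ, hΘθ, hΘ⟩ := exists_isInner_of_wandering hθ1 fun w hw =>
    (Submodule.mem_orthogonal' _ _).1 hθN _ (hshift w hw hθM)
  refine ⟨Θ, hΘ, ?_⟩
  rw [hΘθ]
  have hKM : cyclicSpace θ ≤ cyclicSpace f := cyclicSpace_mono hθM
  -- elements of the cyclic space of `f` orthogonal to `θ` lie in `N`
  have hMN {x : H2 ι} (hx : x ∈ cyclicSpace f) (hxθ : inner ℂ θ x = 0) : x ∈ N := by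
    have := map_mem_of_mem_cyclicSpace (f := f) (M := N)
      (ContinuousLinearMap.id ℂ (H2 ι) - (innerSL ℂ θ).smulRight θ) hNc (fun w => ?_) hx
    · simpa [hxθ] using this
    · by_cases hw : w = []
      · subst hw
        have h1 : inner ℂ θ f = (‖v‖ : ℂ) := by
          have : f = (‖v‖ : ℂ) • θ + N.starProjection f := by rw [← hvθ, hv]; abel
          rw [this, inner_add_right, inner_smul_right, inner_self_eq_norm_sq_to_K, hθ1,
            (Submodule.mem_orthogonal' _ _).1 hθN _ (N.starProjection_apply_mem f)]
          simp
        have h2 : f - (‖v‖ : ℂ) • θ = N.starProjection f := by rw [← hvθ, hv]; abel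
        have h3 : f - (‖v‖ : ℂ) • θ ∈ N := h2 ▸ N.starProjection_apply_mem f
        simpa [h1] using h3
      · simp [(Submodule.mem_orthogonal' _ _).1 hθN _ (hmemN w hw), hmemN w hw]
  -- the orthogonal complement of the cyclic space of `θ` in that of `f` is invariant under
  -- backward shifts and has vanishing constant coefficients, so it is trivial
  have hzero (w : Word ι) : ∀ x ∈ cyclicSpace f, x ∈ (cyclicSpace θ)ᗮ → x w = 0 := by
    induction w using List.reverseRecOn with
    | nil =>
      intro x hx hxK
      refine hN_le (hcoeff []) (fun w hw => ?_)
        (hMN hx ((Submodule.mem_orthogonal _ _).1 hxK _ (self_mem_cyclicSpace θ)))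
      exact rightMono_apply_of_not_suffix (by simpa using hw) f
    | append_singleton w k ih =>
      intro x hx hxK
      rw [← adjoint_rightMono_apply]
      refine ih _ ?_ ?_
      · have hxN := hMN hx ((Submodule.mem_orthogonal _ _).1 hxK _ (self_mem_cyclicSpace θ))
        refine hN_le (M := (cyclicSpace f).comap
          (adjoint (rightMono [k]).toContinuousLinearMap : H2 ι →ₗ[ℂ] H2 ι))
          ((isClosed_cyclicSpace f).preimage (ContinuousLinearMap.continuous _))
          (fun u hu => ?_) hxN
        obtain ⟨u, l, rfl⟩ := (List.eq_nil_or_concat' u).resolve_left hu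
        change adjoint (rightMono [k]).toContinuousLinearMap (rightMono (u ++ [l]) f) ∈
          cyclicSpace f
        rw [rightMono_append]
        by_cases hkl : k = l
        · subst hkl
          convert rightMono_mem_cyclicSpace u f using 1
          ext v
          rw [adjoint_rightMono_apply, rightMono_apply_append]
        · convert Submodule.zero_mem _ using 1
          refine ext_inner_left ℂ fun y => ?_
          rw [adjoint_inner_right, inner_zero_right]
          exact rightMono_singleton_inner _ _ hkl
      · rw [Submodule.mem_orthogonal]
        intro y hy
        rw [adjoint_inner_right]
        exact (Submodule.mem_orthogonal _ _).1 hxK _ (rightMono_mem_of_mem_cyclicSpace hy [k])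
  have : CompleteSpace (cyclicSpace θ) := (isClosed_cyclicSpace θ).completeSpace_coe
  refine le_antisymm hKM (cyclicSpace_mono ?_)
  have hsub : f - (cyclicSpace θ).starProjection f = 0 := by
    ext w
    exact hzero w _ (Submodule.sub_mem _ (self_mem_cyclicSpace f)
      (hKM (Submodule.starProjection_apply_mem _ f)))
      (Submodule.sub_starProjection_mem_orthogonal f)
  rw [sub_eq_zero] at hsub
  rw [hsub]
  exact Submodule.starProjection_apply_mem _ f

/-- The inner-outer factorization in `H²`. -/
theorem exists_inner_outer {f : H2 ι} (hf : f ≠ 0) :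
    ∃ (Θ : Hinf ι) (g : H2 ι), IsInner Θ ∧ IsOuter g ∧ mulL Θ g = f := by
  obtain ⟨Θ, hΘ, h⟩ := exists_isInner_cyclicSpace_eq hf
  obtain ⟨g, hg⟩ := hΘ.mem_cyclicSpace.1 (h ▸ self_mem_cyclicSpace f)
  exact ⟨Θ, g, hΘ, hΘ.isOuter_iff_cyclicSpace_mulL.2 (by rw [hg, h]), hg⟩

/-! ### Evaluation at strict row contractions -/

section Eval

variable {E : Type*} [NormedAddCommGroup E] [NormedSpace ℂ E]

/-- The row operator `(x_i) ↦ ∑ Z_i x_i` has norm at most `r`. -/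
def HasRowBound (Z : ι → E →L[ℂ] E) (r : ℝ) : Prop :=
  0 ≤ r ∧ ∀ (s : Finset ι) (x : ι → E), ‖∑ i ∈ s, Z i (x i)‖ ^ 2 ≤ r ^ 2 * ∑ i ∈ s, ‖x i‖ ^ 2

lemma isStrictRowContraction_iff {Z : ι → E →L[ℂ] E} :
    IsStrictRowContraction Z ↔ ∃ r < 1, HasRowBound Z r :=
  ⟨fun ⟨r, h0, h1, h⟩ => ⟨r, h1, h0, h⟩, fun ⟨r, h1, h0, h⟩ => ⟨r, h0, h1, h⟩⟩

lemma HasRowBound.smul {Z : ι → E →L[ℂ] E} {r : ℝ} (h : HasRowBound Z r) {c : ℝ} (hc : 0 ≤ c) :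
    HasRowBound (fun i => (c : ℂ) • Z i) (c * r) := by
  refine ⟨mul_nonneg hc h.1, fun s x => ?_⟩
  have : ∑ i ∈ s, ((c : ℂ) • Z i) (x i) = (c : ℂ) • ∑ i ∈ s, Z i (x i) := by
    simp [Finset.smul_sum]
  rw [this, norm_smul, mul_pow, mul_pow, mul_assoc]
  have hcn : ‖(c : ℂ)‖ = c := by simp [abs_of_nonneg hc]
  rw [hcn]
  exact mul_le_mul_of_nonneg_left (h.2 s x) (sq_nonneg c)

lemma IsStrictRowContraction.smul {Z : ι → E →L[ℂ] E} (h : IsStrictRowContraction Z)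
    (c : unitInterval) : IsStrictRowContraction (fun i => ((c : ℝ) : ℂ) • Z i) := by
  obtain ⟨r, hr, h⟩ := isStrictRowContraction_iff.1 h
  exact isStrictRowContraction_iff.2
    ⟨_, (mul_le_of_le_one_left h.1 c.2.2).trans_lt hr, h.smul c.2.1⟩

/-- The words of length less than `N` with letters in the finite set `I`. -/
def shortWords (I : Finset ι) : ℕ → Finset (Word ι)
  | 0 => ∅
  | N + 1 => Finset.cons [] ((I ×ˢ shortWords I N).map
      ⟨fun p => p.1 :: p.2, fun p q h => by
        simp only [List.cons.injEq] at h; exact Prod.ext h.1 h.2⟩) (by simp)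

lemma mem_shortWords {I : Finset ι} {N : ℕ} {w : Word ι} :
    w ∈ shortWords I N ↔ w.length < N ∧ ∀ i ∈ w, i ∈ I := by
  induction N generalizing w with
  | zero => simp [shortWords]
  | succ N ih =>
    cases w with
    | nil => simp [shortWords]
    | cons a w =>
      simp only [shortWords, Finset.mem_cons, reduceCtorEq, false_or, Finset.mem_map,
        Finset.mem_product, Prod.exists, ih,
        List.length_cons, add_lt_add_iff_right, List.forall_mem_cons]
      constructor
      · rintro ⟨b, v, ⟨hb, hv⟩, h⟩
        obtain ⟨rfl, rfl⟩ := List.cons.inj h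
        exact ⟨hv.1, hb, hv.2⟩
      · rintro ⟨h1, h2, h3⟩
        exact ⟨a, w, ⟨h2, h1, h3⟩, rfl⟩

lemma exists_subset_shortWords (s : Finset (Word ι)) : ∃ I N, s ⊆ shortWords I N := by
  classical
  refine ⟨s.biUnion List.toFinset, s.sup List.length + 1, fun w hw => mem_shortWords.2 ⟨?_, ?_⟩⟩
  · exact Nat.lt_succ_of_le (Finset.le_sup (f := List.length) hw)
  · intro i hi
    exact Finset.mem_biUnion.2 ⟨w, hw, by simpa using hi⟩

lemma sum_shortWords_succ {A : Type*} [AddCommMonoid A] (I : Finset ι) (N : ℕ) (φ : Word ι → A) :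
    ∑ w ∈ shortWords I (N + 1), φ w =
      φ [] + ∑ i ∈ I, ∑ w ∈ shortWords I N, φ (i :: w) := by
  rw [shortWords, Finset.sum_cons, Finset.sum_map, Finset.sum_product]
  rfl

/-- The row of all words in a row contraction of norm at most `r < 1` has norm at most
`(1 - r²)^{-1/2}`. -/
lemma HasRowBound.norm_sum_words_le {Z : ι → E →L[ℂ] E} {r : ℝ} (h : HasRowBound Z r) (hr : r < 1)
    (s : Finset (Word ι)) (x : Word ι → E) :
    (1 - r ^ 2) * ‖∑ w ∈ s, (w.map Z).prod (x w)‖ ^ 2 ≤ ∑ w ∈ s, ‖x w‖ ^ 2 := by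
  have h0 := h.1
  have hr2 : 0 < 1 - r ^ 2 := by nlinarith
  have key (I : Finset ι) (N : ℕ) : ∀ x : Word ι → E,
      (1 - r ^ 2) * ‖∑ w ∈ shortWords I N, (w.map Z).prod (x w)‖ ^ 2 ≤
        ∑ w ∈ shortWords I N, ‖x w‖ ^ 2 := by
    induction N with
    | zero => intro x; simp [shortWords]
    | succ N ih =>
      intro x
      rw [sum_shortWords_succ, sum_shortWords_succ]
      set y : ι → E := fun i => ∑ w ∈ shortWords I N, (w.map Z).prod (x (i :: w)) with hy
      have hsum : ∑ i ∈ I, ∑ w ∈ shortWords I N, ((i :: w).map Z).prod (x (i :: w)) =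
          ∑ i ∈ I, Z i (y i) := by
        refine Finset.sum_congr rfl fun i _ => ?_
        simp [hy]
      rw [hsum]
      set a := ‖x []‖
      set b := ‖∑ i ∈ I, Z i (y i)‖
      set T := ∑ i ∈ I, ∑ w ∈ shortWords I N, ‖x (i :: w)‖ ^ 2
      have hT : (1 - r ^ 2) * ∑ i ∈ I, ‖y i‖ ^ 2 ≤ T := by
        rw [Finset.mul_sum]
        exact Finset.sum_le_sum fun i _ => ih fun w => x (i :: w)
      have hb : b ^ 2 ≤ r ^ 2 * ∑ i ∈ I, ‖y i‖ ^ 2 := h.2 I y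
      have hbT : (1 - r ^ 2) * b ^ 2 ≤ r ^ 2 * T := by nlinarith [sq_nonneg r]
      have hab : ‖((([] : Word ι).map Z).prod (x []) + ∑ i ∈ I, Z i (y i))‖ ≤ a + b := by
        simpa using norm_add_le (x []) (∑ i ∈ I, Z i (y i))
      have hT0 : 0 ≤ T := Finset.sum_nonneg fun i _ => Finset.sum_nonneg fun w _ => sq_nonneg _
      have hab2 := pow_le_pow_left₀ (norm_nonneg _) hab 2
      refine (mul_le_mul_of_nonneg_left hab2 hr2.le).trans ?_
      rcases h0.eq_or_lt with rfl | hpos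
      · have : b = 0 := by nlinarith
        rw [this]
        nlinarith
      · -- multiplied by `r²`, the defect is at least `(r² a - (1 - r²) b)²`
        refine le_of_mul_le_mul_left (a := r ^ 2) ?_ (by positivity)
        nlinarith [sq_nonneg (r ^ 2 * a - (1 - r ^ 2) * b)]
  classical
  obtain ⟨I, N, hs⟩ := exists_subset_shortWords s
  have := key I N fun w => if w ∈ s then x w else 0
  have e1 : ∑ w ∈ shortWords I N, (w.map Z).prod (if w ∈ s then x w else 0) =
      ∑ w ∈ s, (w.map Z).prod (x w) := by
    rw [← Finset.sum_subset hs fun w _ hw => by simp [hw]]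
    exact Finset.sum_congr rfl fun w hw => by simp [hw]
  have e2 : ∑ w ∈ shortWords I N, ‖if w ∈ s then x w else 0‖ ^ 2 = ∑ w ∈ s, ‖x w‖ ^ 2 := by
    rw [← Finset.sum_subset hs fun w _ hw => by simp [hw]]
    exact Finset.sum_congr rfl fun w hw => by simp [hw]
  rwa [e1, e2] at this

lemma HasRowBound.norm_sum_smul_le {Z : ι → E →L[ℂ] E} {r : ℝ} (h : HasRowBound Z r) (hr : r < 1)
    (s : Finset (Word ι)) (f : Word ι → ℂ) :
    ‖∑ w ∈ s, f w • (w.map Z).prod‖ ≤ √((1 - r ^ 2)⁻¹ * ∑ w ∈ s, ‖f w‖ ^ 2) := by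
  have h0 := h.1
  have hr2 : 0 < 1 - r ^ 2 := by nlinarith
  refine ContinuousLinearMap.opNorm_le_bound _ (Real.sqrt_nonneg _) fun x => ?_
  rw [← sq_le_sq₀ (norm_nonneg _) (by positivity), mul_pow,
    Real.sq_sqrt (mul_nonneg (inv_nonneg.2 hr2.le) (Finset.sum_nonneg fun _ _ => sq_nonneg _))]
  have := h.norm_sum_words_le hr s fun w => f w • x
  simp only [map_smul, norm_smul, mul_pow, ← Finset.sum_mul] at this
  rw [mul_assoc, ← div_eq_inv_mul, le_div_iff₀' hr2]
  simpa [sum_apply] using this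

lemma IsStrictRowContraction.summable_eval [CompleteSpace E] {Z : ι → E →L[ℂ] E}
    (h : IsStrictRowContraction Z) (f : H2 ι) : Summable fun w => f w • (w.map Z).prod := by
  obtain ⟨r, hr, h⟩ := isStrictRowContraction_iff.1 h
  have h0 := h.1
  have hr2 : 0 < 1 - r ^ 2 := by nlinarith
  rw [summable_iff_vanishing_norm]
  intro ε hε
  obtain ⟨s, hs⟩ := summable_iff_vanishing_norm.1 (summable_norm_sq f) ((1 - r ^ 2) * ε ^ 2)
    (by positivity)
  refine ⟨s, fun t ht => (h.norm_sum_smul_le hr t f).trans_lt ?_⟩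
  rw [Real.sqrt_lt' hε, ← div_eq_inv_mul, div_lt_iff₀' hr2]
  exact (le_abs_self _).trans_lt (hs t ht)

/-- Evaluation at a strict row contraction, as a bounded operator on `H²`. -/
def evalL [CompleteSpace E] (Z : ι → E →L[ℂ] E) (h : IsStrictRowContraction Z) :
    H2 ι →L[ℂ] (E →L[ℂ] E) :=
  LinearMap.mkContinuousOfExistsBound
    { toFun := fun f => eval f Z
      map_add' := fun f g => by
        rw [eval, eval, eval, ← (h.summable_eval f).tsum_add (h.summable_eval g)]
        exact tsum_congr fun w => by rw [lp.coeFn_add, Pi.add_apply, add_smul]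
      map_smul' := fun c f => by
        rw [eval, eval, RingHom.id_apply, ← (h.summable_eval f).tsum_const_smul c]
        exact tsum_congr fun w => by rw [lp.coeFn_smul, Pi.smul_apply, smul_assoc] }
    (by
      obtain ⟨r, hr, h'⟩ := isStrictRowContraction_iff.1 h
      have h0 := h'.1
      have hr2 : 0 < 1 - r ^ 2 := by nlinarith
      refine ⟨√((1 - r ^ 2)⁻¹), fun f => ?_⟩
      refine le_of_tendsto (h.summable_eval f).hasSum.norm (Eventually.of_forall fun s => ?_)
      refine (h'.norm_sum_smul_le hr s f).trans ?_
      rw [← Real.sqrt_sq (norm_nonneg f), ← Real.sqrt_mul (by positivity), norm_sq_eq_tsum]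
      exact Real.sqrt_le_sqrt (mul_le_mul_of_nonneg_left
        ((summable_norm_sq f).sum_le_tsum s fun _ _ => sq_nonneg _) (by positivity)))

lemma evalL_apply [CompleteSpace E] {Z : ι → E →L[ℂ] E} (h : IsStrictRowContraction Z)
    (f : H2 ι) : evalL Z h f = eval f Z := rfl

lemma eval_mono (Z : ι → E →L[ℂ] E) (w : Word ι) : eval (mono w) Z = (w.map Z).prod := by
  rw [eval, tsum_eq_single w fun v hv => by rw [mono_apply_ne hv, zero_smul], mono_apply_self,
    one_smul]

lemma eval_one (Z : ι → E →L[ℂ] E) : eval (mono []) Z = 1 := by simp [eval_mono]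

variable [CompleteSpace E]

lemma eval_rightMono {Z : ι → E →L[ℂ] E} (h : IsStrictRowContraction Z) (w : Word ι) (f : H2 ι) :
    eval (rightMono w f) Z = eval f Z * (w.map Z).prod := by
  have : evalL Z h ∘L (rightMono w).toContinuousLinearMap =
      (ContinuousLinearMap.mul ℂ (E →L[ℂ] E)).flip (w.map Z).prod ∘L evalL Z h :=
    clm_ext fun v => by simp [evalL_apply, eval_mono]
  exact DFunLike.congr_fun this f

lemma eval_mulL {Z : ι → E →L[ℂ] E} (h : IsStrictRowContraction Z) (F : Hinf ι) (g : H2 ι) :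
    eval (mulL F g) Z = eval (F : H2 ι) Z * eval g Z := by
  have : evalL Z h ∘L mulL F =
      ContinuousLinearMap.mul ℂ (E →L[ℂ] E) (eval (F : H2 ι) Z) ∘L evalL Z h :=
    clm_ext fun v => by
      simp only [ContinuousLinearMap.coe_comp, Function.comp_apply, mulL_mono, evalL_apply,
        eval_rightMono h, eval_mono, ContinuousLinearMap.mul_apply']
  exact DFunLike.congr_fun this g

/-- Evaluations are compatible with intertwining operators. -/
lemma eval_intertwine {E' : Type*} [NormedAddCommGroup E'] [NormedSpace ℂ E'] [CompleteSpace E']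
    {Z : ι → E →L[ℂ] E} {Z' : ι → E' →L[ℂ] E'} (hZ : IsStrictRowContraction Z)
    (hZ' : IsStrictRowContraction Z') (U : E →L[ℂ] E') (h : ∀ i x, Z' i (U x) = U (Z i x))
    (f : H2 ι) (x : E) : eval f Z' (U x) = U (eval f Z x) := by
  have hw (w : Word ι) (x : E) : (w.map Z').prod (U x) = U ((w.map Z).prod x) := by
    induction w with
    | nil => simp
    | cons a w ih => simp [ih, h]
  have h1 := (hZ'.summable_eval f).hasSum.mapL (ContinuousLinearMap.apply ℂ E' (U x))
  have h2 := ((hZ.summable_eval f).hasSum.mapL (ContinuousLinearMap.apply ℂ E x)).mapL U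
  simp only [ContinuousLinearMap.apply_apply, hw,
    map_smul] at h1 h2
  exact h1.unique h2

/-- If all values of `F` at `Z` have range in a closed subspace `M`, then so do the values of all
elements of the cyclic subspace of `F`. -/
lemma eval_mem_of_mem_cyclicSpace {Z : ι → E →L[ℂ] E} (h : IsStrictRowContraction Z) {F x : H2 ι}
    (hx : x ∈ cyclicSpace F) {M : Submodule ℂ E} (hM : IsClosed (M : Set E))
    (hF : ∀ v, eval F Z v ∈ M) (v : E) : eval x Z v ∈ M := by
  refine map_mem_of_mem_cyclicSpace (ContinuousLinearMap.apply ℂ E v ∘L evalL Z h) hM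
    (fun w => ?_) hx
  simp only [ContinuousLinearMap.coe_comp, Function.comp_apply, evalL_apply, eval_rightMono h,
    ContinuousLinearMap.apply_apply, mul_apply_eq_comp]
  exact hF _

/-- The values of an outer function have right inverses: if `g p` is close to `1` in `H²`, then
`g(Z) p(Z)` is close to the identity, hence invertible. -/
lemma IsOuter.exists_right_inverse {g : H2 ι} (hg : IsOuter g) {Z : ι → E →L[ℂ] E}
    (h : IsStrictRowContraction Z) : ∃ K, eval g Z * K = 1 := by
  let M : Submodule ℂ (E →L[ℂ] E) := LinearMap.range (LinearMap.mulLeft ℂ (eval g Z))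
  have h1 : (1 : E →L[ℂ] E) ∈ M.topologicalClosure := by
    rw [← eval_one Z, ← evalL_apply h]
    refine map_mem_of_mem_cyclicSpace (f := g) (evalL Z h) M.isClosed_topologicalClosure
      (fun w => M.le_topologicalClosure ?_) (isOuter_iff.1 hg ▸ Submodule.mem_top)
    rw [evalL_apply, eval_rightMono h]
    exact ⟨_, rfl⟩
  obtain ⟨_, hA, K, rfl⟩ := mem_closure_iff.1 h1 {A | IsUnit A} Units.isOpen isUnit_one
  obtain ⟨u, hu⟩ := hA
  refine ⟨K * ↑u⁻¹, ?_⟩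
  rw [← mul_assoc, ← Units.mul_inv u, hu]
  rfl

end Eval

/-! ### Dilations -/

/-- The dilation `f ↦ f(c 𝔷)` for `c ∈ [0, 1]`: the coefficient at `w` is multiplied by
`c ^ |w|`. -/
def dilate (c : unitInterval) : H2 ι →L[ℂ] H2 ι :=
  have key (f : H2 ι) (w : Word ι) : ‖((c : ℝ) : ℂ) ^ w.length * f w‖ ≤ ‖f w‖ := by
    rw [norm_mul, norm_pow, Complex.norm_real, Real.norm_of_nonneg c.2.1]
    exact mul_le_of_le_one_left (norm_nonneg _) (pow_le_one₀ c.2.1 c.2.2)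
  LinearMap.mkContinuous
    { toFun := fun f => ⟨fun w => ((c : ℝ) : ℂ) ^ w.length * f w,
        (memℓp_norm_iff.2 (lp.memℓp f)).mono (key f)⟩
      map_add' := fun f g => lp.ext (funext fun w => mul_add _ _ _)
      map_smul' := fun a f => lp.ext (funext fun w => mul_left_comm _ _ _) }
    1 fun f => by
      rw [one_mul]
      exact lp.norm_mono (by norm_num) (key f)

@[simp] lemma dilate_apply (c : unitInterval) (f : H2 ι) (w : Word ι) :
    dilate c f w = ((c : ℝ) : ℂ) ^ w.length * f w := rfl

lemma norm_dilate_le (c : unitInterval) (f : H2 ι) : ‖dilate c f‖ ≤ ‖f‖ := by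
  refine lp.norm_mono (by norm_num) fun w => ?_
  rw [dilate_apply, norm_mul, norm_pow, Complex.norm_real, Real.norm_of_nonneg c.2.1]
  exact mul_le_of_le_one_left (norm_nonneg _) (pow_le_one₀ c.2.1 c.2.2)

lemma dilate_dilate (c d : unitInterval) (f : H2 ι) :
    dilate c (dilate d f) = dilate (c * d) f := by
  ext w; simp [mul_pow, mul_assoc]

lemma dilate_ne_zero {c : unitInterval} (hc : 0 < (c : ℝ)) {f : H2 ι} (hf : f ≠ 0) :
    dilate c f ≠ 0 := by
  contrapose! hf
  ext w
  have := congr_arg (fun g : H2 ι => g w) hf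
  simpa [hc.ne'] using this

lemma dilate_mono (c : unitInterval) (w : Word ι) :
    dilate c (mono w) = ((c : ℝ) : ℂ) ^ w.length • mono w := by
  ext v
  by_cases h : v = w
  · subst h; simp
  · simp [mono_apply_ne h]

lemma dilate_rightMono (c : unitInterval) (w : Word ι) (f : H2 ι) :
    dilate c (rightMono w f) = ((c : ℝ) : ℂ) ^ w.length • rightMono w (dilate c f) := by
  have : dilate c ∘L (rightMono w).toContinuousLinearMap =
      ((c : ℝ) : ℂ) ^ w.length • ((rightMono w).toContinuousLinearMap ∘L dilate c) :=
    clm_ext fun v => by simp [dilate_mono, smul_smul, pow_add, mul_comm]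
  exact DFunLike.congr_fun this f

lemma coe_dilate_mulL (c : unitInterval) (F : Hinf ι) (g : H2 ι) :
    (dilate c (mulL F g) : Word ι → ℂ) = seriesMul (dilate c (F : H2 ι)) (dilate c g) := by
  funext w
  simp only [dilate_apply, coe_mulL, seriesMul, Finset.mul_sum]
  refine Finset.sum_congr rfl fun i hi => ?_
  have : w.length = (w.take i).length + (w.drop i).length := by
    rw [← List.length_append, List.take_append_drop]
  rw [this, pow_add]
  ring

lemma dilate_mem_cyclicSpace {f x : H2 ι} (hx : x ∈ cyclicSpace f) (c : unitInterval) :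
    dilate c x ∈ cyclicSpace (dilate c f) :=
  map_mem_of_mem_cyclicSpace (dilate c) (isClosed_cyclicSpace _) (fun w => by
    rw [dilate_rightMono]
    exact Submodule.smul_mem _ _ (rightMono_mem_cyclicSpace _ _)) hx

lemma prod_map_smul {E : Type*} [NormedAddCommGroup E] [NormedSpace ℂ E] (c : ℂ)
    (Z : ι → E →L[ℂ] E) (w : Word ι) :
    (w.map fun i => c • Z i).prod = c ^ w.length • (w.map Z).prod := by
  induction w with
  | nil => simp
  | cons a w ih => simp [ih, smul_smul, pow_succ]

lemma eval_dilate {E : Type*} [NormedAddCommGroup E] [NormedSpace ℂ E] (c : unitInterval)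
    (f : H2 ι) (Z : ι → E →L[ℂ] E) :
    eval (dilate c f) Z = eval f (fun i => ((c : ℝ) : ℂ) • Z i) :=
  tsum_congr fun w => by
    rw [prod_map_smul, smul_smul, dilate_apply, mul_comm]

lemma continuous_dilate (f : H2 ι) : Continuous fun c : unitInterval => dilate c f := by
  have hlim : TendstoUniformly
      (fun (s : Finset (Word ι)) (c : unitInterval) => dilate c (∑ w ∈ s, f w • mono w))
      (fun c => dilate c f) atTop := by
    rw [Metric.tendstoUniformly_iff]
    intro ε hε
    filter_upwards [Metric.tendsto_nhds.1 (hasSum_mono f) ε hε] with s hs c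
    rw [dist_comm, dist_eq_norm, ← map_sub]
    exact (norm_dilate_le c _).trans_lt (by rwa [← dist_eq_norm])
  refine hlim.continuous (Frequently.of_forall fun s => ?_)
  simp only [map_sum, map_smul, dilate_mono]
  fun_prop

/-! ### The left shifts and dilated multipliers -/

/-- The scaled tuple `c L` of left free shifts on `H²`. -/
def scaledShift (c : unitInterval) (k : ι) : H2 ι →L[ℂ] H2 ι :=
  ((c : ℝ) : ℂ) • (leftMono [k]).toContinuousLinearMap

lemma scaledShift_apply (c : unitInterval) (k : ι) (g : H2 ι) :
    scaledShift c k g = ((c : ℝ) : ℂ) • leftMono [k] g := rfl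

lemma isStrictRowContraction_scaledShift {c : unitInterval} (hc : (c : ℝ) < 1) :
    IsStrictRowContraction (scaledShift c : ι → H2 ι →L[ℂ] H2 ι) := by
  have horth : OrthogonalFamily ℂ (fun _ : ι => H2 ι) fun k => leftMono [k] := by
    intro k l hkl x y
    rw [lp.inner_eq_tsum]
    refine (tsum_congr fun w => ?_).trans tsum_zero
    by_cases hw : ∃ u, [k] ++ u = w
    · obtain ⟨u, rfl⟩ := hw
      have : leftMono [l] y ([k] ++ u) = 0 := pushforward_apply_of_notMem _ _ fun ⟨v, hv⟩ =>
        hkl (by simpa using (List.append_inj_left hv rfl).symm)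
      rw [this, inner_zero_right]
    · have : leftMono [k] x w = 0 := pushforward_apply_of_notMem _ _ hw
      rw [this, inner_zero_left]
  have h1 : HasRowBound (fun k : ι => (leftMono [k]).toContinuousLinearMap) 1 :=
    ⟨zero_le_one, fun s x => by
      rw [one_pow, one_mul]
      exact (horth.norm_sum x s).le⟩
  exact isStrictRowContraction_iff.2 ⟨_, by simpa using hc, h1.smul c.2.1⟩

lemma prod_map_scaledShift (c : unitInterval) (w : Word ι) (g : H2 ι) :
    (w.map (scaledShift c)).prod g = ((c : ℝ) : ℂ) ^ w.length • leftMono w g := by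
  induction w with
  | nil =>
    simp only [List.map_nil, List.prod_nil, one_apply_eq_self, List.length_nil,
      pow_zero, one_smul]
    ext v
    exact (pushforward_apply (e := fun v => [] ++ v) _ g v).symm
  | cons a w ih =>
    rw [List.map_cons, List.prod_cons, mul_apply_eq_comp, ih, map_smul,
      ← List.singleton_append, leftMono_append, List.length_append, pow_add, scaledShift_apply,
      smul_smul, mul_comm, List.length_singleton, pow_one]

/-- For `c < 1`, the dilation of any `f ∈ H²` is a multiplier, whose multiplication operator is the
value `f(c L)` of `f` at the scaled left shifts. -/
lemma exists_mulL_dilate {c : unitInterval} (hc : (c : ℝ) < 1) (f : H2 ι) :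
    ∃ h : dilate c f ∈ Hinf ι, mulL ⟨dilate c f, h⟩ = eval f (scaledShift c) := by
  refine exists_mulL_eq _ _ fun w => ?_
  have h1 := ((isStrictRowContraction_scaledShift hc).summable_eval f).hasSum.mapL
    (ContinuousLinearMap.apply ℂ (H2 ι) (mono w))
  have h2 := (hasSum_mono (dilate c f)).mapL (rightMono w).toContinuousLinearMap
  simp only [ContinuousLinearMap.apply_apply, prod_map_scaledShift, map_smul, leftMono_mono,
    LinearIsometry.coe_toContinuousLinearMap,
    rightMono_mono, smul_smul, dilate_apply, mul_comm] at h1 h2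
  exact h1.unique h2

/-! ### Invertibility of values -/

/-- In a Banach algebra, a path of right-invertible elements which starts at an invertible element
stays invertible. -/
lemma isUnit_of_path {A : Type*} [NormedRing A] [CompleteSpace A] {a : unitInterval → A}
    (ha : Continuous a) (h0 : IsUnit (a 0)) (hr : ∀ t, ∃ K, a t * K = 1) : IsUnit (a 1) := by
  have hopen : IsOpen {t | IsUnit (a t)} := Units.isOpen.preimage ha
  have hclosed : IsClosed {t | IsUnit (a t)} := by
    refine isClosed_of_closure_subset fun t ht => ?_
    obtain ⟨K, hK⟩ := hr t
    have hn : {s | IsUnit (a s * K)} ∈ 𝓝 t := by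
      refine (Units.isOpen.preimage (ha.mul continuous_const)).mem_nhds ?_
      simp [hK]
    obtain ⟨s, hs1, hs2⟩ := mem_closure_iff_nhds.1 ht _ hn
    have hKu : IsUnit K := by
      obtain ⟨u, hu⟩ := hs2
      have : K = ↑u⁻¹ * (a s * K) := by rw [← mul_assoc, ← hu]; simp
      rw [this]
      exact (Units.isUnit _).mul hs1
    obtain ⟨k, rfl⟩ := hKu
    exact ⟨k⁻¹, (Units.mul_eq_one_iff_eq_inv.1 hK).symm⟩
  have huniv := IsClopen.eq_univ ⟨hclosed, hopen⟩ ⟨0, h0⟩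
  exact Set.eq_univ_iff_forall.1 huniv 1

/-- If all values of `f` at strict row contractions have right inverses, then they are
invertible, because they are connected to the scalar `f(0)` by the path `t ↦ f(tZ)`. -/
lemma isUnit_eval_of_right_inverse {E : Type*} [NormedAddCommGroup E] [NormedSpace ℂ E]
    [CompleteSpace E] {f : H2 ι}
    (hf : ∀ Z : ι → E →L[ℂ] E, IsStrictRowContraction Z → ∃ K, eval f Z * K = 1)
    {Z : ι → E →L[ℂ] E} (h : IsStrictRowContraction Z) : IsUnit (eval f Z) := by
  have hr (t : unitInterval) : ∃ K, eval (dilate t f) Z * K = 1 := by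
    rw [eval_dilate]; exact hf _ (h.smul t)
  have hd0 : dilate 0 f = f [] • mono [] := by
    ext w
    cases w with
    | nil => simp
    | cons a w => simp [mono_apply_ne]
  have h0 : eval (dilate 0 f) Z = f [] • 1 := by
    rw [hd0, ← evalL_apply h, map_smul, evalL_apply, eval_one]
  have hd1 : dilate 1 f = f := by ext w; simp
  rw [← hd1]
  refine isUnit_of_path (a := fun t => eval (dilate t f) Z)
    ((evalL Z h).continuous.comp (continuous_dilate f)) ?_ hr
  obtain ⟨K, hK⟩ := hr 0
  refine ⟨⟨_, K, hK, ?_⟩, rfl⟩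
  rw [h0] at hK ⊢
  simpa using hK

/-! ### The singularity space in terms of cyclic subspaces -/

/-- A strict row contraction is a dilate, by some `0 < c < 1`, of a strict row contraction. -/
lemma IsStrictRowContraction.exists_dilate {E : Type*} [NormedAddCommGroup E] [NormedSpace ℂ E]
    {Z : ι → E →L[ℂ] E} (h : IsStrictRowContraction Z) :
    ∃ (c : unitInterval) (W : ι → E →L[ℂ] E), 0 < (c : ℝ) ∧ (c : ℝ) < 1 ∧
      IsStrictRowContraction W ∧ ∀ f : H2 ι, eval f Z = eval (dilate c f) W := by
  obtain ⟨r, hr, h⟩ := isStrictRowContraction_iff.1 h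
  have h0 := h.1
  have hc0 : 0 < (r + 1) / 2 := by linarith
  have hcn : (((r + 1) / 2 : ℝ) : ℂ) ≠ 0 := by exact_mod_cast hc0.ne'
  refine ⟨⟨(r + 1) / 2, hc0.le, by linarith⟩, fun i => ((((r + 1) / 2)⁻¹ : ℝ) : ℂ) • Z i, hc0,
    by simp only; linarith, isStrictRowContraction_iff.2 ⟨_, ?_, h.smul (inv_nonneg.2 hc0.le)⟩,
    fun f => ?_⟩
  · rw [← div_eq_inv_mul, div_lt_one hc0]
    linarith
  · rw [eval_dilate]
    congr 1
    funext i
    simp only [Complex.ofReal_inv]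
    rw [smul_inv_smul₀ hcn]

lemma exists_equiv_level_top [Countable ι] [Nonempty ι] :
    Nonempty (Word ι ≃ {k : ℕ // (k : ℕ∞) < ⊤}) := by
  have : Infinite {k : ℕ // (k : ℕ∞) < ⊤} :=
    Infinite.of_injective (fun n : ℕ => ⟨n, ENat.natCast_lt_top n⟩) fun a b h => by simpa using h
  exact nonempty_equiv_of_countable

/-- The scaled left shifts `c L` on `H²` are unitarily equivalent to a strict row contraction at the
level `∞`. -/
lemma exists_level_top_shift [Countable ι] [Nonempty ι] {c : unitInterval} (hc : (c : ℝ) < 1) :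
    ∃ (U : H2 ι →ₗᵢ[ℂ] Level ⊤) (Z : ι → Level ⊤ →L[ℂ] Level ⊤), Function.Surjective U ∧
      IsStrictRowContraction Z ∧
      ∀ (f x : H2 ι), eval f Z (U x) = U (eval f (scaledShift c) x) := by
  obtain ⟨e⟩ := exists_equiv_level_top (ι := ι)
  obtain ⟨U, hU⟩ : ∃ U : H2 ι →ₗᵢ[ℂ] Level ⊤, U = pushforward e e.injective := ⟨_, rfl⟩
  obtain ⟨V, hV⟩ : ∃ V : Level ⊤ →ₗᵢ[ℂ] H2 ι, V = pushforward e.symm e.symm.injective := ⟨_, rfl⟩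
  have hVU (x : H2 ι) : V (U x) = x := by
    ext w
    have h1 : V (U x) (e.symm (e w)) = U x (e w) := hV ▸ pushforward_apply _ _ _
    rw [e.symm_apply_apply] at h1
    rw [h1, hU]
    exact pushforward_apply _ _ _
  have hUV (z : Level ⊤) : U (V z) = z := V.injective (hVU _)
  have hL := isStrictRowContraction_scaledShift (ι := ι) hc
  obtain ⟨Z, hZU⟩ : ∃ Z : ι → Level ⊤ →L[ℂ] Level ⊤, ∀ k z, Z k z = U (scaledShift c k (V z)) :=
    ⟨fun k => U.toContinuousLinearMap ∘L scaledShift c k ∘L V.toContinuousLinearMap,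
      fun _ _ => rfl⟩
  have hZ : IsStrictRowContraction Z := by
    obtain ⟨r, h0, h1, h2⟩ := hL
    refine ⟨r, h0, h1, fun s x => ?_⟩
    have := h2 s fun k => V (x k)
    simp only [LinearIsometry.norm_map] at this
    simpa only [← U.norm_map (∑ i ∈ s, _), map_sum, ← hZU] using this
  exact ⟨U, Z, fun z => ⟨V z, hUV z⟩, hZ, fun f x =>
    eval_intertwine hL hZ U.toContinuousLinearMap (fun k x => by
      simp only [LinearIsometry.coe_toContinuousLinearMap, hZU, hVU]) f x⟩

lemma mk_mem_sing {H : H2 ι} {n : ℕ∞} {Z : ι → Level n →L[ℂ] Level n} {y : Level n} :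
    (⟨n, Z, y⟩ : Σ n : ℕ∞, (ι → Level n →L[ℂ] Level n) × Level n) ∈ Sing H ↔
      n ≠ 0 ∧ IsStrictRowContraction Z ∧ ∀ x, inner ℂ y (eval H Z x) = 0 := Iff.rfl

lemma mem_singSpace {H h : H2 ι} :
    h ∈ singSpace H ↔ ∀ (n : ℕ∞) (Z : ι → Level n →L[ℂ] Level n) (y : Level n), n ≠ 0 →
      IsStrictRowContraction Z → (∀ x, inner ℂ y (eval H Z x) = 0) →
      ∀ x, inner ℂ y (eval h Z x) = 0 :=
  ⟨fun hh n Z y hn hZ hy => hh ⟨n, Z, y⟩ ⟨hn, hZ, hy⟩,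
    fun hh p hp => hh p.1 p.2.1 p.2.2 hp.1 hp.2.1 hp.2.2⟩

/-- `h` is in the singularity space of `H` iff every proper dilate of `h` is in the cyclic subspace
of the corresponding dilate of `H`. The points of `Sing H` which detect this are the scaled left
shifts `c L`, moved from `H²` to the level `∞` by a unitary. -/
theorem mem_singSpace_iff [Countable ι] [Nonempty ι] {H h : H2 ι} :
    h ∈ singSpace H ↔ ∀ c : unitInterval, 0 < (c : ℝ) → (c : ℝ) < 1 →
      dilate c h ∈ cyclicSpace (dilate c H) := by
  rw [mem_singSpace]
  constructor
  · intro hh c _ hc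
    obtain ⟨U, Z, hU, hZ, hint⟩ := exists_level_top_shift (ι := ι) hc
    have : CompleteSpace (cyclicSpace (dilate c H)) := (isClosed_cyclicSpace _).completeSpace_coe
    rw [← Submodule.orthogonal_orthogonal (cyclicSpace (dilate c H)), Submodule.mem_orthogonal]
    intro x hx
    have h1 := hh ⊤ Z (U x) (by simp) hZ (fun z => by
      obtain ⟨z, rfl⟩ := hU z
      obtain ⟨hF, hFe⟩ := exists_mulL_dilate hc H
      rw [hint, LinearIsometry.inner_map_map, ← hFe]
      exact (Submodule.mem_orthogonal' _ _).1 hx _ (mulL_mem_cyclicSpace ⟨dilate c H, hF⟩ z))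
      (U (mono []))
    obtain ⟨hF, hFe⟩ := exists_mulL_dilate hc h
    rwa [hint, LinearIsometry.inner_map_map, ← hFe, mulL_one] at h1
  · intro hh n Z y _ hZ hy x
    obtain ⟨c, W, hc0, hc1, hW, he⟩ := IsStrictRowContraction.exists_dilate hZ
    simp only [he] at hy ⊢
    have := eval_mem_of_mem_cyclicSpace hW (hh c hc0 hc1) (M := (ℂ ∙ y)ᗮ)
      (Submodule.isClosed_orthogonal _)
      (fun v => Submodule.mem_orthogonal_singleton_iff_inner_right.2 (hy v)) x
    exact Submodule.mem_orthogonal_singleton_iff_inner_right.1 this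

lemma self_mem_singSpace (H : H2 ι) : H ∈ singSpace H := 
  mem_singSpace.2 fun _ _ _ _ _ hy => hy

lemma mulL_mem_singSpace {H : H2 ι} {B : Hinf ι} (hB : (B : H2 ι) ∈ singSpace H) (g : H2 ι) :
    mulL B g ∈ singSpace H := by
  rw [mem_singSpace] at hB ⊢
  intro n Z y hn hZ hy x
  rw [eval_mulL hZ]
  exact hB n Z y hn hZ hy _

/-! ### The Blaschke factor -/

/-- Coefficientwise compactness of bounded sequences in `H²`. -/
lemma exists_ultrafilter_lim (𝒰 : Ultrafilter ℕ) {u : ℕ → H2 ι} {C : ℝ} (hu : ∀ n, ‖u n‖ ≤ C) :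
    ∃ x : H2 ι, ‖x‖ ≤ C ∧ ∀ w, Tendsto (fun n => u n w) 𝒰 (𝓝 (x w)) := by
  have hlim (w : Word ι) : ∃ a : ℂ, Tendsto (fun n => u n w) 𝒰 (𝓝 a) := by
    have hmem : ∀ n, u n w ∈ Metric.closedBall (0 : ℂ) C := fun n =>
      mem_closedBall_zero_iff.2 ((lp.norm_apply_le_norm (by norm_num) (u n) w).trans (hu n))
    obtain ⟨a, _, ha⟩ := (isCompact_closedBall (0 : ℂ) C).ultrafilter_le_nhds
      (𝒰.map fun n => u n w) (tendsto_principal.2 (Eventually.of_forall hmem))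
    exact ⟨a, ha⟩
  choose a ha using hlim
  have hpi : Tendsto (fun n => (u n : Word ι → ℂ)) 𝒰 (𝓝 a) := tendsto_pi_nhds.2 ha
  have hbdd : Bornology.IsBounded (Set.range u) :=
    isBounded_iff_forall_norm_le.2 ⟨C, by rintro _ ⟨n, rfl⟩; exact hu n⟩
  refine ⟨⟨a, lp.memℓp_of_tendsto (E := fun _ : Word ι => ℂ) hbdd hpi⟩, ?_, ha⟩
  exact lp.norm_le_of_tendsto (E := fun _ : Word ι => ℂ) (F := u) (Eventually.of_forall hu) hpi

/-- The product of coefficientwise limits in `H²` is the coefficientwise limit of the products. -/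
lemma seriesMul_eq_of_tendsto {κ : Type*} {l : Filter κ} [l.NeBot] {F G : κ → H2 ι} {f g : H2 ι}
    {x : Word ι → ℂ} (hF : ∀ w, Tendsto (fun k => F k w) l (𝓝 (f w)))
    (hG : ∀ w, Tendsto (fun k => G k w) l (𝓝 (g w)))
    (hx : ∀ w, Tendsto (fun k => seriesMul (F k) (G k) w) l (𝓝 (x w))) : seriesMul f g = x :=
  funext fun w => tendsto_nhds_unique (tendsto_seriesMul hF hG w) (hx w)

/-- The singularity space of a non-zero `H` is the range of an inner multiplier `B`.
The cyclic subspaces of the dilates `H(c 𝔷)` are ranges of inner multipliers `Φ_c`, and `B` is a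
coefficientwise limit of `Φ_c` as `c → 1`. Dividing `h(c 𝔷)` by `Φ_c` shows in the limit that any
`h` in the singularity space is of the form `h = B g` with `‖g‖ ≤ ‖h‖`; as `B` itself lies in the
singularity space, this estimate forces `B` to be isometric. -/
theorem exists_isInner_singSpace_eq [Countable ι] [Nonempty ι] {H : H2 ι} (hH : H ≠ 0) :
    ∃ B : Hinf ι, IsInner B ∧ ∀ h, h ∈ singSpace H ↔ ∃ g, mulL B g = h := by
  obtain ⟨c', -, hc', hclim⟩ := exists_seq_strictMono_tendsto' (zero_lt_one (α := ℝ))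
  let c : ℕ → unitInterval := fun n => ⟨c' n, (hc' n).1.le, (hc' n).2.le⟩
  have hc0 (n : ℕ) : 0 < (c n : ℝ) := (hc' n).1
  have hc1 (n : ℕ) : (c n : ℝ) < 1 := (hc' n).2
  let 𝒰 : Ultrafilter ℕ := hyperfilter ℕ
  have h𝒰 : (𝒰 : Filter ℕ) ≤ atTop := Nat.hyperfilter_le_atTop
  have hc : Tendsto (fun n => (c n : ℝ)) 𝒰 (𝓝 1) := hclim.mono_left h𝒰
  choose Φ hΦ hΦc using fun n => exists_isInner_cyclicSpace_eq (dilate_ne_zero (hc0 n) hH)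
  obtain ⟨b, -, hb⟩ := exists_ultrafilter_lim 𝒰 (u := fun n => (Φ n : H2 ι))
    fun n => (hΦ n).norm_eq_one.le
  have hprod (g : H2 ι) : ∃ x : H2 ι, ‖x‖ ≤ ‖g‖ ∧ (x : Word ι → ℂ) = seriesMul b g := by
    obtain ⟨x, hx, hxlim⟩ := exists_ultrafilter_lim 𝒰 (u := fun n => mulL (Φ n) g)
      fun n => ((hΦ n).norm_mulL g).le
    have hlim (w : Word ι) :
        Tendsto (fun n => seriesMul (Φ n : H2 ι) g w) 𝒰 (𝓝 (x w)) := hxlim w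
    exact ⟨x, hx, (seriesMul_eq_of_tendsto (F := fun n => (Φ n : H2 ι)) (G := fun _ => g) hb
      (fun _ => tendsto_const_nhds) hlim).symm⟩
  let B : Hinf ι := ⟨b, fun g => by obtain ⟨x, -, hx⟩ := hprod g; exact hx ▸ lp.memℓp x⟩
  have hBle (g : H2 ι) : ‖mulL B g‖ ≤ ‖g‖ := by
    obtain ⟨x, hx, hxe⟩ := hprod g
    have he : mulL B g = x := lp.ext ((coe_mulL B g).trans hxe.symm)
    rwa [he]
  have hdiv (h : H2 ι) (hh : h ∈ singSpace H) : ∃ g, ‖g‖ ≤ ‖h‖ ∧ mulL B g = h := by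
    have (n : ℕ) : ∃ g, ‖g‖ ≤ ‖h‖ ∧ mulL (Φ n) g = dilate (c n) h := by
      have hmem := mem_singSpace_iff.1 hh (c n) (hc0 n) (hc1 n)
      rw [← hΦc] at hmem
      obtain ⟨g, hg⟩ := (hΦ n).mem_cyclicSpace.1 hmem
      exact ⟨g, by rw [← (hΦ n).norm_mulL, hg]; exact norm_dilate_le _ _, hg⟩
    choose g hg hge using this
    obtain ⟨x, hx, hxlim⟩ := exists_ultrafilter_lim 𝒰 hg
    refine ⟨x, hx, lp.ext (seriesMul_eq_of_tendsto (F := fun n => (Φ n : H2 ι)) (G := g) hb hxlim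
      fun w => ?_)⟩
    have he (n : ℕ) : seriesMul (Φ n : H2 ι) (g n) w = ((c n : ℝ) : ℂ) ^ w.length * h w := by
      rw [← coe_mulL, hge, dilate_apply]
    simp only [he]
    have h1 : Tendsto (fun n => ((c n : ℝ) : ℂ)) 𝒰 (𝓝 ((1 : ℝ) : ℂ)) :=
      (Complex.continuous_ofReal.tendsto 1).comp hc
    rw [Complex.ofReal_one] at h1
    simpa using (h1.pow w.length).mul_const (h w)
  have hBmem : (B : H2 ι) ∈ singSpace H := by
    refine mem_singSpace_iff.2 fun d hd0 hd1 => ?_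
    obtain ⟨Ψ, hΨ, hΨc⟩ := exists_isInner_cyclicSpace_eq (dilate_ne_zero hd0 hH)
    -- for `d < c n`, the dilate of `Φ n` by `d / c n` lies in the range of `Ψ`
    have (n : ℕ) : ∃ g : H2 ι, ‖g‖ ≤ 1 ∧ ((d : ℝ) < c n → ∀ w,
        seriesMul (Ψ : H2 ι) g w = (((d / c n : ℝ) : ℂ)) ^ w.length * (Φ n : H2 ι) w) := by
      by_cases hdc : (d : ℝ) < c n
      · let q : unitInterval := ⟨d / c n, unitInterval.div_mem d.2.1 (c n).2.1 hdc.le⟩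
        have hq : q * c n = d := Subtype.ext (div_mul_cancel₀ _ (hc0 n).ne')
        have hmem : dilate q (Φ n : H2 ι) ∈ cyclicSpace (Ψ : H2 ι) := by
          rw [hΨc, ← hq, ← dilate_dilate]
          refine dilate_mem_cyclicSpace ?_ q
          rw [← hΦc]
          exact self_mem_cyclicSpace _
        obtain ⟨g, hg⟩ := hΨ.mem_cyclicSpace.1 hmem
        refine ⟨g, ?_, fun _ w => ?_⟩
        · rw [← hΨ.norm_mulL, hg, ← (hΦ n).norm_eq_one]
          exact norm_dilate_le _ _
        · rw [← coe_mulL, hg]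
          rfl
      · exact ⟨0, by simp, fun h => absurd h hdc⟩
    choose g hg hge using this
    obtain ⟨x, -, hxlim⟩ := exists_ultrafilter_lim 𝒰 hg
    rw [← hΨc]
    refine hΨ.mem_cyclicSpace.2 ⟨x, lp.ext (seriesMul_eq_of_tendsto (F := fun _ => (Ψ : H2 ι))
      (G := g) (fun _ => tendsto_const_nhds) hxlim fun w => ?_)⟩
    have hq : Tendsto (fun n => ((d / c n : ℝ) : ℂ)) 𝒰 (𝓝 ((d : ℝ) : ℂ)) := by
      have := (tendsto_const_nhds (x := (d : ℝ))).div hc one_ne_zero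
      rw [div_one] at this
      exact (Complex.continuous_ofReal.tendsto _).comp this
    refine ((hq.pow w.length).mul (hb w)).congr' ?_
    filter_upwards [hc.eventually (lt_mem_nhds hd1)] with n hn
    exact (hge n hn w).symm
  have hB0 : (B : H2 ι) ≠ 0 := by
    intro h0
    obtain ⟨g, -, hg⟩ := hdiv H (self_mem_singSpace H)
    refine hH (hg ▸ lp.ext ?_)
    rw [coe_mulL, h0]
    funext w
    simp [seriesMul]
  refine ⟨B, isInner_iff.2 fun p => le_antisymm (hBle p) ?_, fun h => ⟨fun hh => ?_, ?_⟩⟩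
  · obtain ⟨g, hg, hge⟩ := hdiv _ (mulL_mem_singSpace hBmem p)
    rwa [mulL_injective hB0 hge] at hg
  · obtain ⟨g, -, hg⟩ := hdiv h hh
    exact ⟨g, hg⟩
  · rintro ⟨g, rfl⟩
    exact mulL_mem_singSpace hBmem g

/-- The cofactor of the Blaschke factor takes invertible values. If `Φ` is the inner factor of the
dilate of `H = B G`, then `Φ` divides the dilate of `B`, so that the outer factor of the dilate of
`H` is `A · G(c 𝔷)` for some multiplier `A`. -/
theorem isUnit_eval_of_mulL_eq [Countable ι] [Nonempty ι] {H G : H2 ι} (hH : H ≠ 0) {B : Hinf ι}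
    (hB : (B : H2 ι) ∈ singSpace H) (hBG : mulL B G = H) {E : Type*} [NormedAddCommGroup E]
    [NormedSpace ℂ E] [CompleteSpace E] {Z : ι → E →L[ℂ] E} (hZ : IsStrictRowContraction Z) :
    IsUnit (eval G Z) := by
  obtain ⟨c, W, hc0, hc1, hW, he⟩ := hZ.exists_dilate
  rw [he]
  obtain ⟨Φ, K, hΦ, hK, hΦK⟩ := exists_inner_outer (dilate_ne_zero hc0 hH)
  have hΦc : cyclicSpace (Φ : H2 ι) = cyclicSpace (dilate c H) := by
    rw [← hΦK, (hΦ.isOuter_iff_cyclicSpace_mulL.1 hK)]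
  obtain ⟨A, hA⟩ := hΦ.mem_cyclicSpace.1 (hΦc ▸ mem_singSpace_iff.1 hB c hc0 hc1)
  obtain ⟨hBc, -⟩ := exists_mulL_dilate hc1 (B : H2 ι)
  obtain ⟨hA', -⟩ := hΦ.mem_Hinf_of_mul (H := ⟨_, hBc⟩) hA
  have hKA : mulL ⟨A, hA'⟩ (dilate c G) = K := by
    refine mulL_injective hΦ.ne_zero (lp.ext ?_)
    rw [hΦK, ← hBG, coe_dilate_mulL, ← hA, coe_mulL, coe_mulL, coe_mulL, seriesMul_assoc]
  have heval {V : ι → E →L[ℂ] E} (hV : IsStrictRowContraction V) :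
      eval K V = eval A V * eval (dilate c G) V := by
    rw [← hKA, eval_mulL hV]
  have hAunit : IsUnit (eval A W) := by
    refine isUnit_eval_of_right_inverse (fun V hV => ?_) hW
    obtain ⟨T, hT⟩ := hK.exists_right_inverse hV
    exact ⟨_, by rw [← mul_assoc, ← heval hV, hT]⟩
  have hKunit : IsUnit (eval K W) :=
    isUnit_eval_of_right_inverse (fun V hV => hK.exists_right_inverse hV) hW
  rw [heval hW] at hKunit
  exact hAunit.mul_left_iff.1 hKunit

/-! ### Existence of the factorization -/

theorem exists_factorization [Countable ι] [Nonempty ι] {H : H2 ι} (hH : H ≠ 0) :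
    ∃ (B S : Hinf ι) (F : H2 ι), IsBlaschke B ∧ Sing (B : H2 ι) = Sing H ∧ IsSingular S ∧
      (∀ (n : ℕ∞) (Z : ι → Level n →L[ℂ] Level n), IsStrictRowContraction Z →
        IsUnit (eval (S : H2 ι) Z)) ∧ IsOuter F ∧ H = leftMul B (leftMul S F) := by
  obtain ⟨B, hB, hBs⟩ := exists_isInner_singSpace_eq hH
  obtain ⟨G, hG⟩ := (hBs H).1 (self_mem_singSpace H)
  have hG0 : G ≠ 0 := by
    rintro rfl
    exact hH (by rw [← hG, map_zero])
  obtain ⟨S, F, hS, hF, hSF⟩ := exists_inner_outer hG0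
  have hGunit (n : ℕ∞) (Z : ι → Level n →L[ℂ] Level n) (hZ : IsStrictRowContraction Z) :
      IsUnit (eval G Z) :=
    isUnit_eval_of_mulL_eq hH ((hBs B).2 ⟨mono [], mulL_one B⟩) hG hZ
  have hSunit (n : ℕ∞) (Z : ι → Level n →L[ℂ] Level n) (hZ : IsStrictRowContraction Z) :
      IsUnit (eval (S : H2 ι) Z) := by
    refine isUnit_eval_of_right_inverse (fun V hV => ?_) hZ
    obtain ⟨T, hT⟩ := (hGunit n V hV).exists_right_inv
    rw [← hSF, eval_mulL hV, mul_assoc] at hT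
    exact ⟨_, hT⟩
  have hSing : Sing (B : H2 ι) = Sing H := by
    ext ⟨n, Z, y⟩
    rw [mk_mem_sing, mk_mem_sing]
    refine and_congr_right fun _ => and_congr_right fun hZ => ?_
    constructor
    · intro h x
      rw [← hG, eval_mulL hZ]
      exact h _
    · intro h x
      obtain ⟨T, hT⟩ := (hGunit n Z hZ).exists_right_inv
      have := h (T x)
      rwa [← hG, eval_mulL hZ, ← mul_apply_eq_comp, mul_assoc, hT, mul_one] at this
  refine ⟨B, S, F, ⟨hB, ?_⟩, hSing, ⟨hS, Set.eq_univ_of_forall fun h => mem_singSpace.2 ?_⟩,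
    hSunit, hF, ?_⟩
  · rw [singSpace, hSing]
    ext h
    exact (hBs h).symm
  · intro n Z y _ hZ hy x
    obtain ⟨T, hT⟩ := (hSunit n Z hZ).exists_right_inv
    have := hy (T (eval h Z x))
    rwa [← mul_apply_eq_comp, hT] at this
  · rw [← mulL_apply, ← mulL_apply, hSF, hG]

/-! ### Uniqueness of the factorization -/

/-- Inner multipliers with the same range agree up to a unimodular constant. -/
lemma IsInner.eq_smul_of_cyclicSpace_eq {Θ Θ' : Hinf ι} (hΘ : IsInner Θ) (hΘ' : IsInner Θ')
    (h : cyclicSpace (Θ : H2 ι) = cyclicSpace (Θ' : H2 ι)) :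
    ∃ c : ℂ, ‖c‖ = 1 ∧ (Θ' : H2 ι) = c • (Θ : H2 ι) := by
  obtain ⟨u, hu⟩ := hΘ.mem_cyclicSpace.1 (h ▸ self_mem_cyclicSpace (Θ' : H2 ι))
  obtain ⟨v, hv⟩ := hΘ'.mem_cyclicSpace.1 (h ▸ self_mem_cyclicSpace (Θ : H2 ι))
  have hu1 : ‖u‖ = 1 := by rw [← hΘ.norm_mulL, hu, hΘ'.norm_eq_one]
  have hv1 : ‖v‖ = 1 := by rw [← hΘ'.norm_mulL, hv, hΘ.norm_eq_one]
  have huv : seriesMul u v = (mono [] : H2 ι) := by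
    refine seriesMul_left_cancel (f := (Θ : H2 ι))
      (by rw [ne_eq, ← lp.eq_zero_iff_coeFn_eq_zero]; exact hΘ.ne_zero) ?_
    rw [← seriesMul_assoc, ← coe_mulL, hu, ← coe_mulL, hv, ← coe_mulL, mulL_one]
  have h0 : u [] * v [] = 1 := by
    rw [← seriesMul_nil, huv, mono_apply_self]
  have hun : ‖u []‖ ≤ 1 := hu1 ▸ lp.norm_apply_le_norm (by norm_num) u []
  have hvn : ‖v []‖ ≤ 1 := hv1 ▸ lp.norm_apply_le_norm (by norm_num) v []
  have hun1 : ‖u []‖ = 1 := by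
    have := congr_arg norm h0
    rw [norm_mul, norm_one] at this
    nlinarith [norm_nonneg (u []), norm_nonneg (v [])]
  -- all the mass of `u` sits in its constant coefficient
  have hu' : u = u [] • mono [] := by
    have hs := norm_sq_eq_tsum u
    rw [hu1, one_pow] at hs
    ext w
    by_cases hw : w = []
    · subst hw; simp
    · classical
      have h2 := (summable_norm_sq u).sum_le_tsum ({[], w} : Finset (Word ι)) fun _ _ => sq_nonneg _
      rw [Finset.sum_pair (Ne.symm hw), ← hs, hun1] at h2
      have : ‖u w‖ ^ 2 = 0 := le_antisymm (by linarith) (sq_nonneg _)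
      simpa [mono_apply_ne hw] using this
  refine ⟨u [], hun1, ?_⟩
  rw [← hu, hu', map_smul, mulL_one]
  simp

lemma IsBlaschke.range_eq {B : Hinf ι} (hB : IsBlaschke B) :
    (cyclicSpace (B : H2 ι) : Set (H2 ι)) = singSpace (B : H2 ι) := by
  rw [← hB.2, ← hB.1.range_eq_cyclicSpace]
  rfl

lemma singSpace_eq_of_sing_eq {H H' : H2 ι} (h : Sing H = Sing H') :
    singSpace H = singSpace H' :=
  by simp only [singSpace, h]

/-- Singular inner and outer right factors do not affect the singularity locus: values of `F` are
surjective, and if `y^* B(Z) S(Z) = 0`, then `(Z, B(Z)^* y) ∈ Sing S`, where `1 ∈ singSpace S` gives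
`B(Z)^* y = 0`. -/
lemma sing_eq_of_factorization {B S : Hinf ι} {F : H2 ι} (hS : IsSingular S) (hF : IsOuter F) :
    Sing (mulL B (mulL S F)) = Sing (B : H2 ι) := by
  ext ⟨n, Z, y⟩
  rw [mk_mem_sing, mk_mem_sing]
  refine and_congr_right fun hn => and_congr_right fun hZ => ?_
  rw [eval_mulL hZ, eval_mulL hZ]
  refine ⟨fun h => ?_, fun h x => h _⟩
  obtain ⟨T, hT⟩ := hF.exists_right_inverse hZ
  have h1 : (mono [] : H2 ι) ∈ singSpace (S : H2 ι) := hS.2 ▸ Set.mem_univ _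
  intro x
  have := mem_singSpace.1 h1 n Z (ContinuousLinearMap.adjoint (eval (B : H2 ι) Z) y) hn hZ
    (fun z => ?_) x
  · simpa [eval_one, ContinuousLinearMap.adjoint_inner_left] using this
  · have h2 := h (T z)
    rw [ContinuousLinearMap.adjoint_inner_left]
    rwa [mul_apply_eq_comp, mul_apply_eq_comp, ← mul_apply_eq_comp (eval F Z), hT] at h2

theorem factorization_unique {B S B' S' : Hinf ι} {F F' : H2 ι}
    (hB : IsBlaschke B) (hS : IsSingular S) (hF : IsOuter F)
    (hB' : IsBlaschke B') (hS' : IsSingular S') (hF' : IsOuter F')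
    (h : leftMul B (leftMul S F) = leftMul B' (leftMul S' F')) :
    ∃ b s f : ℂ, ‖b‖ = 1 ∧ ‖s‖ = 1 ∧ ‖f‖ = 1 ∧ (B' : H2 ι) = b • (B : H2 ι) ∧
      (S' : H2 ι) = s • (S : H2 ι) ∧ F' = f • F := by
  simp only [← mulL_apply] at h
  have hsing : Sing (B : H2 ι) = Sing (B' : H2 ι) := by
    rw [← sing_eq_of_factorization (B := B) hS hF, h, sing_eq_of_factorization hS' hF']
  have hsp : singSpace (B : H2 ι) = singSpace (B' : H2 ι) := singSpace_eq_of_sing_eq hsing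
  have hBB' : cyclicSpace (B : H2 ι) = cyclicSpace (B' : H2 ι) :=
    SetLike.coe_injective (hB.range_eq.trans (hsp.trans hB'.range_eq.symm))
  obtain ⟨b, hb, hBb⟩ := hB.1.eq_smul_of_cyclicSpace_eq hB'.1 hBB'
  have hSF : mulL S F = b • mulL S' F' := by
    refine mulL_injective hB.1.ne_zero ?_
    rw [h, map_smul]
    refine lp.ext ?_
    rw [lp.coeFn_smul, coe_mulL B', coe_mulL B (mulL S' F'), hBb, lp.coeFn_smul,
      seriesMul_smul_left]
  have hb0 : b ≠ 0 := by rintro rfl; simp at hb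
  have hcyc : cyclicSpace (mulL S F) = cyclicSpace (mulL S' F') := by
    refine le_antisymm (cyclicSpace_mono ?_) (cyclicSpace_mono ?_)
    · rw [hSF]
      exact Submodule.smul_mem _ _ (self_mem_cyclicSpace _)
    · rw [← inv_smul_smul₀ hb0 (mulL S' F'), ← hSF]
      exact Submodule.smul_mem _ _ (self_mem_cyclicSpace _)
  rw [hS.1.isOuter_iff_cyclicSpace_mulL.1 hF, hS'.1.isOuter_iff_cyclicSpace_mulL.1 hF'] at hcyc
  obtain ⟨s, hs, hSs⟩ := hS.1.eq_smul_of_cyclicSpace_eq hS'.1 hcyc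
  have hs0 : s ≠ 0 := by rintro rfl; simp at hs
  have hFF : F = (b * s) • F' := by
    refine mulL_injective hS.1.ne_zero ?_
    rw [hSF, map_smul, mul_smul]
    congr 1
    refine lp.ext ?_
    rw [lp.coeFn_smul, coe_mulL, coe_mulL, hSs, lp.coeFn_smul, seriesMul_smul_left]
  refine ⟨b, s, (b * s)⁻¹, hb, hs, by simp [hb, hs], hBb, hSs, ?_⟩
  rw [hFF, inv_smul_smul₀ (mul_ne_zero hb0 hs0)]

end NCHardy

end

theorem theorem5 {ι : Type*} [Countable ι] [Nonempty ι] :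
    -- the case of the NC Hardy space `H²`
    (∀ H : NCHardy.H2 ι, H ≠ 0 →
      (∃ (B S : NCHardy.Hinf ι) (F : NCHardy.H2 ι),
        NCHardy.IsBlaschke B ∧ NCHardy.Sing (B : NCHardy.H2 ι) = NCHardy.Sing H ∧
        NCHardy.IsSingular S ∧
        (∀ (n : ℕ∞) (Z : ι → NCHardy.Level n →L[ℂ] NCHardy.Level n),
          NCHardy.IsStrictRowContraction Z → IsUnit (NCHardy.eval (S : NCHardy.H2 ι) Z)) ∧
        NCHardy.IsOuter F ∧
        H = NCHardy.leftMul B (NCHardy.leftMul S F)) ∧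
      (∀ (B S B' S' : NCHardy.Hinf ι) (F F' : NCHardy.H2 ι),
        NCHardy.IsBlaschke B → NCHardy.IsSingular S → NCHardy.IsOuter F →
        H = NCHardy.leftMul B (NCHardy.leftMul S F) →
        NCHardy.IsBlaschke B' → NCHardy.IsSingular S' → NCHardy.IsOuter F' →
        H = NCHardy.leftMul B' (NCHardy.leftMul S' F') →
        ∃ b s f : ℂ, ‖b‖ = 1 ∧ ‖s‖ = 1 ∧ ‖f‖ = 1 ∧
          (B' : NCHardy.H2 ι) = b • (B : NCHardy.H2 ι) ∧
          (S' : NCHardy.H2 ι) = s • (S : NCHardy.H2 ι) ∧ F' = f • F)) ∧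
    -- the case of the NC Hardy algebra `H^∞`
    (∀ H : NCHardy.Hinf ι, (H : NCHardy.H2 ι) ≠ 0 →
      (∃ B S F : NCHardy.Hinf ι,
        NCHardy.IsBlaschke B ∧ NCHardy.Sing (B : NCHardy.H2 ι) = NCHardy.Sing (H : NCHardy.H2 ι) ∧
        NCHardy.IsSingular S ∧
        (∀ (n : ℕ∞) (Z : ι → NCHardy.Level n →L[ℂ] NCHardy.Level n),
          NCHardy.IsStrictRowContraction Z → IsUnit (NCHardy.eval (S : NCHardy.H2 ι) Z)) ∧
        NCHardy.IsOuterInf F ∧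
        (H : NCHardy.H2 ι) = NCHardy.leftMul B (NCHardy.leftMul S F)) ∧
      (∀ B S F B' S' F' : NCHardy.Hinf ι,
        NCHardy.IsBlaschke B → NCHardy.IsSingular S → NCHardy.IsOuterInf F →
        (H : NCHardy.H2 ι) = NCHardy.leftMul B (NCHardy.leftMul S F) →
        NCHardy.IsBlaschke B' → NCHardy.IsSingular S' → NCHardy.IsOuterInf F' →
        (H : NCHardy.H2 ι) = NCHardy.leftMul B' (NCHardy.leftMul S' F') →
        ∃ b s f : ℂ, ‖b‖ = 1 ∧ ‖s‖ = 1 ∧ ‖f‖ = 1 ∧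
          (B' : NCHardy.H2 ι) = b • (B : NCHardy.H2 ι) ∧
          (S' : NCHardy.H2 ι) = s • (S : NCHardy.H2 ι) ∧
          (F' : NCHardy.H2 ι) = f • (F : NCHardy.H2 ι))) := by
  refine ⟨fun H hH => ⟨NCHardy.exists_factorization hH, ?_⟩, fun H hH => ⟨?_, ?_⟩⟩
  · intro B S B' S' F F' hB hS hF h hB' hS' hF' h'
    exact NCHardy.factorization_unique hB hS hF hB' hS' hF' (h ▸ h')
  · obtain ⟨B, S, F, hB, hSing, hS, hSu, hF, h⟩ := NCHardy.exists_factorization hH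
    -- dividing the multiplier `H` by the inner factors `B` and `S` leaves multipliers
    obtain ⟨hG, -⟩ := hB.1.mem_Hinf_of_mul h.symm
    obtain ⟨hF', -⟩ := hS.1.mem_Hinf_of_mul (H := ⟨_, hG⟩) (G := F) rfl
    exact ⟨B, S, ⟨F, hF'⟩, hB, hSing, hS, hSu, NCHardy.isOuterInf_iff.2 hF, h⟩
  · intro B S F B' S' F' hB hS hF h hB' hS' hF' h'
    exact NCHardy.factorization_unique hB hS (NCHardy.isOuterInf_iff.1 hF) hB' hS'
      (NCHardy.isOuterInf_iff.1 hF') (h ▸ h')
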